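/- Let $n\ge 1$ and let $\rho:(0,\infty)\to(0,\infty)$ be measurable. A function $\Phi:[0,\infty]\to[0,\infty]$ is a Young function if it is convex, left-continuous, $\lim_{r\to 0+}\Phi(r)=\Phi(0)=0$ and $\lim_{r\to\infty}\Phi(r)=\Phi(\infty)=\infty$; its generalized inverse is $\Phi^{-1}(s)=\inf\{r\ge 0:\Phi(r)>s\}$ with $\inf\emptyset=\infty$, and $\Phi\in\nabla_2$ means that, for some $C>1$, $\Phi(r)\le\frac1{2C}\Phi(Cr)$ for all $r\ge 0$. For real-valued (or, alternatively, complex-valued) functions, let $L^\Phi(\mathbb R^n)$ be the set of all $f\in L^1_{\rm loc}(\mathbb R^n)$ with $\int_{\mathbb R^n}\Phi(k|f(x)|)\,dx<\infty$ for some $k>0$, with the norm $\|f\|_{L^\Phi}=\inf\{\lambda>0:\int_{\mathbb R^n}\Phi(|f(x)|/\lambda)\,dx\le 1\}$, and let ${\rm W}L^\Phi(\mathbb R^n)$ be the set of all measurable $f$ with $\|f\|_{{\rm W}L^\Phi}=\sup_{\lambda>0}\|\lambda\chi_{\{|f|>\lambda\}}\|_{L^\Phi}<\infty$. Let $$I_\rho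 f(x)=\int_{\mathbb R^n}\frac{\rho(|x-y|)}{|x-y|^n}f(y)\,dy .$$ We say that $I_\rho$ is bounded from $L^\Phi$ to $X$ (with $X=L^\Psi$ or $X={\rm W}L^\Psi$) if for every $f\in L^\Phi$ the integral defining $I_\rho f(x)$ converges absolutely for almost every $x$, $I_\rho f\in X$, and $\|I_\rho f\|_X\le C\|f\|_{L^\Phi}$ with a constant $C$ independent of $f$. Consider the conditions $$\text{(a)}\quad \int_0^1\frac{\rho(t)}{t}\,dt<\infty ;$$ (b) there are constants $C>0$ and $0<k_1<k_2$ such that for all $r>0$ $$\sup_{r/2\le t\le r}\rho(t)\le C\int_{k_1r}^{k_2r}\frac{\rho(t)}{t}\,dt .$$ **Theorem.** Let $\Phi,\Psi$ be Young functions. 1. Let $\rho$ satisfy (a) and (b). If there is a constant $C>0$ such that for all $r>0$ $$\Phi^{-1}(r^{-n})\int_0^r\frac{\rho(t)}{t}\,dt+\int_r^\infty\rho(t)\,\Phi^{-1}(t^{-n})\,\frac{dt}{t}\le C\,\Psi^{-1}(r^{-n}),$$ then $I_\rho$ is bounded from $L^\Phi(\mathbb R^n)$ to ${\rm W}L^\Psi(\mathbb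 R^n)$; if moreover $\Phi\in\nabla_2$, then $I_\rho$ is bounded from $L^\Phi(\mathbb R^n)$ to $L^\Psi(\mathbb R^n)$. 2. If $I_\rho$ is bounded from $L^\Phi(\mathbb R^n)$ to ${\rm W}L^\Psi(\mathbb R^n)$, or from $L^\Phi(\mathbb R^n)$ to $L^\Psi(\mathbb R^n)$, then there is a constant $C>0$ such that for all $r>0$ $$\Phi^{-1}(r^{-n})\int_0^r\frac{\rho(t)}{t}\,dt\le C\,\Psi^{-1}(r^{-n}).\qquad (*)$$ 3. Let $\rho$ satisfy (a) and (b), and suppose that there is a constant $C>0$ such that for all $r>0$ $$\int_r^\infty\rho(t)\,\Phi^{-1}(t^{-n})\,\frac{dt}{t}\le C\,\Psi^{-1}(r^{-n}).$$ Then $I_\rho$ is bounded from $L^\Phi(\mathbb R^n)$ to ${\rm W}L^\Psi(\mathbb R^n)$ if and only if $(*)$ holds for some $C>0$ and all $r>0$. If moreover $\Phi\in\nabla_2$, then $I_\rho$ is bounded from $L^\Phi(\mathbb R^n)$ to $L^\Psi(\mathbb R^n)$ if and only if $(*)$ holds for some $C>0$ and all $r>0$. -/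

import Mathlib

open MeasureTheory Set Filter Topology
open scoped ENNReal NNReal

noncomputable section

namespace OrliczFrac

/-- Young functions `Φ : [0,∞] → [0,∞]`: convex, left-continuous,
`lim_{r → 0+} Φ r = Φ 0 = 0` and `lim_{r → ∞} Φ r = Φ ∞ = ∞`. -/
structure IsYoung (Φ : ℝ≥0∞ → ℝ≥0∞) : Prop where
  convex : ConvexOn ℝ≥0 Set.univ Φ
  left_continuous : ∀ x, ContinuousWithinAt Φ (Set.Iic x) x
  map_zero : Φ 0 = 0
  tendsto_zero : Tendsto Φ (𝓝[>] 0) (𝓝 0)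
  map_top : Φ ⊤ = ⊤
  tendsto_top : Tendsto Φ (𝓝[<] ⊤) (𝓝 ⊤)

/-- The generalized inverse `Φ⁻¹(s) = inf {r ≥ 0 : Φ(r) > s}`, with `inf ∅ = ∞`. -/
def youngInv (Φ : ℝ≥0∞ → ℝ≥0∞) (s : ℝ≥0∞) : ℝ≥0∞ := sInf {r | s < Φ r}

/-- The condition `∇₂`: for some `C > 1`, `Φ(r) ≤ Φ(C r) / (2 C)` for all `r`. -/
def Nabla2 (Φ : ℝ≥0∞ → ℝ≥0∞) : Prop :=
  ∃ C : ℝ≥0, 1 < C ∧ ∀ r, Φ r ≤ (2 * (C : ℝ≥0∞))⁻¹ * Φ (C * r)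

/-- Euclidean space `ℝⁿ`. -/
abbrev E (n : ℕ) : Type := EuclideanSpace ℝ (Fin n)

section Spaces

variable {n : ℕ} {F : Type*} [NormedAddCommGroup F]

/-- The Luxemburg-Nakano norm `inf {l > 0 : ∫ Φ(|f|/l) ≤ 1}`, equal to `∞` if there is no such `l`. -/
def orliczNorm (Φ : ℝ≥0∞ → ℝ≥0∞) (f : E n → F) : ℝ≥0∞ :=
  sInf {l : ℝ≥0∞ | 0 < l ∧ l < ⊤ ∧ ∫⁻ x, Φ (‖f x‖ₑ / l) ≤ 1}

/-- Membership in the Orlicz space `L^Φ(ℝⁿ)`. -/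
def MemOrlicz (Φ : ℝ≥0∞ → ℝ≥0∞) (f : E n → F) : Prop :=
  LocallyIntegrable f volume ∧ ∃ k : ℝ≥0, 0 < k ∧ ∫⁻ x, Φ (k * ‖f x‖ₑ) < ⊤

/-- The weak quasi-norm `sup_{l > 0} ‖l χ_{|f| > l}‖_{L^Φ}`. -/
def weakOrliczNorm (Φ : ℝ≥0∞ → ℝ≥0∞) (f : E n → F) : ℝ≥0∞ :=
  ⨆ (l : ℝ) (_ : 0 < l), orliczNorm Φ ({x : E n | l < ‖f x‖}.indicator (fun _ => l))

/-- Membership in the weak Orlicz space `WL^Φ(ℝⁿ)`. -/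
def MemWeakOrlicz (Φ : ℝ≥0∞ → ℝ≥0∞) (f : E n → F) : Prop :=
  AEStronglyMeasurable f volume ∧ weakOrliczNorm Φ f < ⊤

end Spaces

section Operator

variable (𝕜 : Type*) [RCLike 𝕜] (n : ℕ)

/-- The integrand `y ↦ ρ(|x-y|) |x-y|^{-n} f(y)` of `I_ρ f(x)`. -/
def fracIntegrand {𝕜 : Type*} [RCLike 𝕜] {n : ℕ} (ρ : ℝ → ℝ) (f : E n → 𝕜) (x y : E n) : 𝕜 :=
  ((ρ ‖x - y‖ / ‖x - y‖ ^ n : ℝ) : 𝕜) * f y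

/-- The generalized fractional integral operator `I_ρ`. -/
def fracInt {𝕜 : Type*} [RCLike 𝕜] {n : ℕ} (ρ : ℝ → ℝ) (f : E n → 𝕜) (x : E n) : 𝕜 :=
  ∫ y, fracIntegrand ρ f x y

/-- `I_ρ` is bounded from `L^Φ(ℝⁿ)` to `L^Ψ(ℝⁿ)`: for every `f` in `L^Φ` the integral defining
`I_ρ f(x)` converges absolutely for almost every `x`, `I_ρ f` belongs to `L^Ψ`, and
`‖I_ρ f‖ ≤ C ‖f‖` with `C` independent of `f`. -/
def StrongBounded (ρ : ℝ → ℝ) (Φ Ψ : ℝ≥0∞ → ℝ≥0∞) : Prop :=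
  ∃ C : ℝ≥0, ∀ f : E n → 𝕜, MemOrlicz Φ f →
    (∀ᵐ x, Integrable (fracIntegrand ρ f x)) ∧ MemOrlicz Ψ (fracInt ρ f) ∧
      orliczNorm Ψ (fracInt ρ f) ≤ C * orliczNorm Φ f

/-- `I_ρ` is bounded from `L^Φ(ℝⁿ)` to `WL^Ψ(ℝⁿ)`. -/
def WeakBounded (ρ : ℝ → ℝ) (Φ Ψ : ℝ≥0∞ → ℝ≥0∞) : Prop :=
  ∃ C : ℝ≥0, ∀ f : E n → 𝕜, MemOrlicz Φ f →
    (∀ᵐ x, Integrable (fracIntegrand ρ f x)) ∧ MemWeakOrlicz Ψ (fracInt ρ f) ∧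
      weakOrliczNorm Ψ (fracInt ρ f) ≤ C * orliczNorm Φ f

end Operator

/-- The integral of `ρ(t)/t` over the set `s`, with values in `[0,∞]`. -/
def logInt (ρ : ℝ → ℝ) (s : Set ℝ) : ℝ≥0∞ := ∫⁻ t in s, ENNReal.ofReal (ρ t / t)

/-- `∫_0^1 ρ(t)/t dt < ∞`. -/
def IntRho (ρ : ℝ → ℝ) : Prop := logInt ρ (Set.Ioc 0 1) < ⊤

/-- For some `C > 0` and `0 < k₁ < k₂`:
`sup_{r/2 ≤ t ≤ r} ρ(t) ≤ C ∫_{k₁ r}^{k₂ r} ρ(t)/t dt` for all `r > 0`. -/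
def SupRho (ρ : ℝ → ℝ) : Prop :=
  ∃ C k₁ k₂ : ℝ, 0 < C ∧ 0 < k₁ ∧ k₁ < k₂ ∧ ∀ r : ℝ, 0 < r →
    (⨆ t ∈ Set.Icc (r / 2) r, ENNReal.ofReal (ρ t)) ≤
      ENNReal.ofReal C * logInt ρ (Set.Ioc (k₁ * r) (k₂ * r))

/-- `Φ⁻¹(r⁻ⁿ)`. -/
def invPow (n : ℕ) (Φ : ℝ≥0∞ → ℝ≥0∞) (r : ℝ) : ℝ≥0∞ := youngInv Φ (ENNReal.ofReal ((r ^ n)⁻¹))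

/-- The local term `Φ⁻¹(r⁻ⁿ) ∫_0^r ρ(t)/t dt`. -/
def localTerm (n : ℕ) (ρ : ℝ → ℝ) (Φ : ℝ≥0∞ → ℝ≥0∞) (r : ℝ) : ℝ≥0∞ :=
  invPow n Φ r * logInt ρ (Set.Ioc 0 r)

/-- The tail term `∫_r^∞ ρ(t) Φ⁻¹(t⁻ⁿ) dt/t`. -/
def tailTerm (n : ℕ) (ρ : ℝ → ℝ) (Φ : ℝ≥0∞ → ℝ≥0∞) (r : ℝ) : ℝ≥0∞ :=
  ∫⁻ t in Set.Ioi r, ENNReal.ofReal (ρ t / t) * invPow n Φ t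

/-- `A(r) ≤ C Ψ⁻¹(r⁻ⁿ)` for all `r > 0`, with `C > 0` independent of `r`. -/
def DominatedBy (n : ℕ) (A : ℝ → ℝ≥0∞) (Ψ : ℝ≥0∞ → ℝ≥0∞) : Prop :=
  ∃ C : ℝ≥0, 0 < C ∧ ∀ r : ℝ, 0 < r → A r ≤ C * invPow n Ψ r

end OrliczFrac

end

/-!
The proof rests on a pointwise comparison of `I_ρ` with the Hardy-Littlewood maximal function `M`,
in the manner of Hedberg.  All estimates are made for `[0,∞]`-valued functions, so that no
integrability has to be known beforehand.

*Pointwise estimate.*  The hypothesis on `ρ` at `r = d` bounds `ρ(d)` by an integral of `ρ(t)/t`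
over `k₁ d < t ≤ k₂ d`.  With `d = |x - y|`, exchanging the order of integration bounds
`I_ρ g(x)` by a multiple of the integral of `ρ(t)/t` times the average of `g` over the ball of
radius `t/k₁` about `x` (`fracLInt_le_lintegral_average`).  If `∫ Φ(g) ≤ 1`, these averages are at
most `M g(x)`, and by Jensen's inequality at most a multiple of `Φ⁻¹(t⁻ⁿ)`.  Using the first bound
for `t ≤ R` and the second for `t > R`, with `R⁻ⁿ` slightly above `Φ(M g(x))`, turns the integral
condition into `Ψ(I_ρ g / A) ≤ Φ(M g)` (`exists_map_fracLInt_le`).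

*Maximal function.*  Since `Φ(M g / 2) ≤ M(Φ ∘ g)`, the weak type `(1,1)` inequality
(`mul_volume_lt_maximalFn_le`, from the Vitali covering lemma) yields a weak modular inequality for
`M`, hence boundedness into the weak space (`weakBounded_of_dominatedBy`).  Under `∇₂`, cutting at
the levels `Cᵏ` gives series dominated by geometric ones, hence the strong modular inequality
(`IsYoung.exists_lintegral_map_maximalFn_le_one`) and boundedness into `L^Ψ`
(`strongBounded_of_dominatedBy`).

*Necessity.*  For the indicator function of the ball of radius `2r`, whose norm is at most a
multiple of `1 / Φ⁻¹((2r)⁻ⁿ)`, polar coordinates show that `I_ρ` is at least a multiple of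
`∫_0^r ρ(t)/t dt` on the ball of radius `r`; the weak norm of such a function is at least a multiple
of that integral divided by `Ψ⁻¹(r⁻ⁿ)` (`dominatedBy_localTerm_of_weakBounded`).
-/

namespace OrliczFrac

/-! ### Young functions and their generalized inverses -/

section Young

variable {Φ : ℝ≥0∞ → ℝ≥0∞}

lemma IsYoung.map_mul_le (h : IsYoung Φ) {θ : ℝ≥0∞} (hθ : θ ≤ 1) (t : ℝ≥0∞) :
    Φ (θ * t) ≤ θ * Φ t := by
  lift θ to ℝ≥0 using ne_top_of_le_ne_top ENNReal.one_ne_top hθ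
  have hθ' : θ ≤ 1 := by exact_mod_cast hθ
  have := h.convex.2 (mem_univ t) (mem_univ 0) (zero_le (a := θ)) (zero_le (a := 1 - θ))
    (add_tsub_cancel_of_le hθ')
  simpa [ENNReal.smul_def, h.map_zero] using this

lemma IsYoung.monotone (h : IsYoung Φ) : Monotone Φ := by
  intro t u htu
  rcases eq_or_ne u ⊤ with rfl | hu
  · simp [h.map_top]
  rcases eq_or_ne u 0 with rfl | hu0
  · simp [le_antisymm htu zero_le]
  have h1 : t / u ≤ 1 := ENNReal.div_le_of_le_mul (by simpa using htu)
  calc Φ t = Φ (t / u * u) := by rw [ENNReal.div_mul_cancel hu0 hu]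
    _ ≤ t / u * Φ u := h.map_mul_le h1 u
    _ ≤ 1 * Φ u := by gcongr
    _ = Φ u := one_mul _

lemma IsYoung.le_map_mul (h : IsYoung Φ) {c : ℝ≥0∞} (hc : 1 ≤ c) (hc' : c ≠ ⊤) (t : ℝ≥0∞) :
    c * Φ t ≤ Φ (c * t) := by
  have hc0 : c ≠ 0 := (zero_lt_one.trans_le hc).ne'
  have := h.map_mul_le (ENNReal.inv_le_one.2 hc) (c * t)
  rw [← mul_assoc, ENNReal.inv_mul_cancel hc0 hc', one_mul] at this
  calc c * Φ t ≤ c * (c⁻¹ * Φ (c * t)) := by gcongr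
    _ = Φ (c * t) := by rw [← mul_assoc, ENNReal.mul_inv_cancel hc0 hc', one_mul]

lemma IsYoung.map_le_of_forall_lt (h : IsYoung Φ) {a s : ℝ≥0∞} (hs : ∀ c < a, Φ c ≤ s) :
    Φ a ≤ s := by
  rcases eq_or_ne a 0 with rfl | ha
  · simp [h.map_zero]
  have : (𝓝[<] a).NeBot := nhdsLT_neBot_of_exists_lt ⟨0, pos_iff_ne_zero.2 ha⟩
  have ht : Tendsto Φ (𝓝[<] a) (𝓝 (Φ a)) :=
    (h.left_continuous a).mono_left (nhdsWithin_mono _ Iio_subset_Iic_self)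
  exact le_of_tendsto ht (eventually_nhdsWithin_of_forall hs)

lemma IsYoung.exists_lt_map (h : IsYoung Φ) {s : ℝ≥0∞} (hs : s < ⊤) : ∃ r < ⊤, s < Φ r := by
  have : (𝓝[<] (⊤ : ℝ≥0∞)).NeBot := nhdsLT_neBot_of_exists_lt ⟨0, by simp⟩
  obtain ⟨r, hr, hr'⟩ :=
    ((h.tendsto_top.eventually_const_lt hs).and self_mem_nhdsWithin).exists
  exact ⟨r, hr', hr⟩

lemma IsYoung.exists_map_le (h : IsYoung Φ) {s : ℝ≥0∞} (hs : 0 < s) :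
    ∃ r, 0 < r ∧ r < ⊤ ∧ Φ r ≤ s := by
  have : (𝓝[>] (0 : ℝ≥0∞)).NeBot := nhdsGT_neBot_of_exists_gt ⟨1, by simp⟩
  have h1 : ∀ᶠ r in 𝓝[>] (0 : ℝ≥0∞), r < 1 :=
    nhdsWithin_le_nhds (Iio_mem_nhds zero_lt_one)
  obtain ⟨r, ⟨hr, hr'⟩, h1⟩ :=
    (((h.tendsto_zero.eventually_lt_const hs).and self_mem_nhdsWithin).and h1).exists
  exact ⟨r, hr', h1.trans ENNReal.one_lt_top, hr.le⟩

lemma youngInv_mono (Φ : ℝ≥0∞ → ℝ≥0∞) : Monotone (youngInv Φ) := fun _ _ hst =>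
  sInf_le_sInf fun _ hr => hst.trans_lt hr

lemma IsYoung.le_youngInv (h : IsYoung Φ) {a s : ℝ≥0∞} (has : Φ a ≤ s) : a ≤ youngInv Φ s := by
  refine le_sInf fun r hr => ?_
  by_contra! hra
  exact absurd (h.monotone hra.le) (not_le.2 (has.trans_lt hr))

lemma IsYoung.map_youngInv_le (h : IsYoung Φ) (s : ℝ≥0∞) : Φ (youngInv Φ s) ≤ s := by
  refine h.map_le_of_forall_lt fun c hc => ?_
  by_contra! hcs
  exact absurd (sInf_le (show c ∈ {r | s < Φ r} from hcs)) (not_le.2 hc)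

lemma IsYoung.youngInv_lt_top (h : IsYoung Φ) {s : ℝ≥0∞} (hs : s < ⊤) : youngInv Φ s < ⊤ := by
  obtain ⟨r, hr, hsr⟩ := h.exists_lt_map hs
  exact (sInf_le (show r ∈ {r | s < Φ r} from hsr)).trans_lt hr

lemma IsYoung.youngInv_pos (h : IsYoung Φ) {s : ℝ≥0∞} (hs : 0 < s) : 0 < youngInv Φ s := by
  obtain ⟨r, hr, -, hsr⟩ := h.exists_map_le hs
  exact hr.trans_le (h.le_youngInv hsr)

lemma IsYoung.youngInv_mul_le (h : IsYoung Φ) {c : ℝ≥0∞} (hc : 1 ≤ c) (hc' : c ≠ ⊤)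
    (s : ℝ≥0∞) : youngInv Φ (c * s) ≤ c * youngInv Φ s := by
  have hc0 : c ≠ 0 := (zero_lt_one.trans_le hc).ne'
  rw [mul_comm c (youngInv Φ s), ← ENNReal.div_le_iff hc0 hc']
  refine le_sInf fun r hr => ENNReal.div_le_of_le_mul' (sInf_le ?_)
  calc c * s < c * Φ r := (ENNReal.mul_lt_mul_iff_right hc0 hc').2 hr
    _ ≤ Φ (c * r) := h.le_map_mul hc hc' r

/-- The affine minorant through `c` that a convex function vanishing at `0` has; truncated
subtraction makes it trivially true below `c`. -/
lemma IsYoung.slope_mul_sub_le (h : IsYoung Φ) {c : ℝ≥0∞} (hc : c ≠ 0) (hc' : c ≠ ⊤)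
    (t : ℝ≥0∞) : Φ c / c * (t - c) ≤ Φ t := by
  rcases le_or_gt t c with htc | htc
  · simp [tsub_eq_zero_of_le htc]
  rcases eq_or_ne t ⊤ with rfl | ht
  · simp [h.map_top]
  have h1 : 1 ≤ t / c := by
    rw [ENNReal.le_div_iff_mul_le (Or.inl hc) (Or.inl hc'), one_mul]; exact htc.le
  calc Φ c / c * (t - c) ≤ Φ c / c * t := by gcongr; exact tsub_le_self
    _ = t / c * Φ c := by rw [ENNReal.div_eq_inv_mul, ENNReal.div_eq_inv_mul]; ring
    _ ≤ Φ (t / c * c) := h.le_map_mul h1 (ENNReal.div_ne_top ht hc) c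
    _ = Φ t := by rw [ENNReal.div_mul_cancel hc hc']

/-- A form of Jensen's inequality with a loss of a factor `2`, valid for extended-valued
functions. -/
lemma IsYoung.map_half_average_le (h : IsYoung Φ) {α : Type*} [MeasurableSpace α]
    {μ : Measure α} (hμ : μ univ ≠ 0) (hμ' : μ univ ≠ ⊤) (g : α → ℝ≥0∞) :
    Φ ((∫⁻ x, g x ∂μ) / μ univ / 2) ≤ (∫⁻ x, Φ (g x) ∂μ) / μ univ := by
  refine h.map_le_of_forall_lt fun c hc => ?_
  rcases eq_or_ne c 0 with rfl | hc0
  · simp [h.map_zero]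
  have hct : c ≠ ⊤ := hc.ne_top
  rw [ENNReal.le_div_iff_mul_le (Or.inl hμ) (Or.inl hμ')]
  have h1 : c * μ univ ≤ (∫⁻ x, g x ∂μ) - c * μ univ := by
    refine ENNReal.le_sub_of_add_le_left (ENNReal.mul_ne_top hct hμ') ?_
    have := (ENNReal.lt_div_iff_mul_lt (by simp) (by simp)).1 hc
    have := (ENNReal.lt_div_iff_mul_lt (Or.inl hμ) (Or.inl hμ')).1 this
    calc c * μ univ + c * μ univ = c * 2 * μ univ := by ring
      _ ≤ _ := this.le
  calc Φ c * μ univ = Φ c / c * (c * μ univ) := by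
        rw [← mul_assoc, ENNReal.div_mul_cancel hc0 hct]
    _ ≤ Φ c / c * ((∫⁻ x, g x ∂μ) - ∫⁻ _, c ∂μ) := by rw [lintegral_const]; gcongr
    _ ≤ Φ c / c * ∫⁻ x, (g x - c) ∂μ := by
        gcongr; exact lintegral_sub_le _ _ measurable_const
    _ ≤ ∫⁻ x, Φ c / c * (g x - c) ∂μ := lintegral_const_mul_le _ _
    _ ≤ ∫⁻ x, Φ (g x) ∂μ := lintegral_mono fun x => h.slope_mul_sub_le hc0 hct _

end Young

/-! ### The Hardy-Littlewood maximal function -/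

section Maximal

variable {n : ℕ}

lemma volume_closedBall_eq (x : E n) {r : ℝ} (hr : 0 ≤ r) :
    volume (Metric.closedBall x r) =
      ENNReal.ofReal (r ^ n) * volume (Metric.ball (0 : E n) 1) := by
  simpa using Measure.addHaar_closedBall (volume : Measure (E n)) x hr

lemma volume_unitBall_ne_zero : volume (Metric.ball (0 : E n) 1) ≠ 0 :=
  (Metric.measure_ball_pos _ _ one_pos).ne'

lemma volume_unitBall_ne_top : volume (Metric.ball (0 : E n) 1) ≠ ⊤ :=
  measure_ball_lt_top.ne

lemma volume_closedBall_ne_zero (x : E n) {r : ℝ} (hr : 0 < r) :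
    volume (Metric.closedBall x r) ≠ 0 :=
  (Metric.measure_closedBall_pos _ _ hr).ne'

lemma volume_closedBall_ne_top (x : E n) (r : ℝ) : volume (Metric.closedBall x r) ≠ ⊤ :=
  measure_closedBall_lt_top.ne

/-- The centered Hardy-Littlewood maximal function of a `[0,∞]`-valued function, taken over closed
balls. -/
noncomputable def maximalFn (g : E n → ℝ≥0∞) (x : E n) : ℝ≥0∞ :=
  ⨆ (r : ℝ) (_ : 0 < r),
    (∫⁻ y in Metric.closedBall x r, g y) / volume (Metric.closedBall x r)

lemma average_le_maximalFn (g : E n → ℝ≥0∞) (x : E n) {r : ℝ} (hr : 0 < r) :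
    (∫⁻ y in Metric.closedBall x r, g y) / volume (Metric.closedBall x r) ≤ maximalFn g x :=
  le_iSup₂_of_le r hr le_rfl

lemma maximalFn_mono {g h : E n → ℝ≥0∞} (hgh : ∀ x, g x ≤ h x) (x : E n) :
    maximalFn g x ≤ maximalFn h x :=
  iSup₂_mono fun _ _ => ENNReal.div_le_div_right (lintegral_mono hgh) _

lemma maximalFn_const_mul {c : ℝ≥0∞} (hc : c ≠ ⊤) (g : E n → ℝ≥0∞) (x : E n) :
    maximalFn (fun y => c * g y) x = c * maximalFn g x := by
  simp only [maximalFn, ENNReal.mul_iSup, lintegral_const_mul' c g hc, mul_div_assoc]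

lemma maximalFn_const_add_le (c : ℝ≥0∞) (g : E n → ℝ≥0∞) (x : E n) :
    maximalFn (fun y => c + g y) x ≤ c + maximalFn g x := by
  refine iSup₂_le fun r hr => ?_
  rw [lintegral_add_left measurable_const, setLIntegral_const, ENNReal.add_div]
  gcongr
  · rw [ENNReal.mul_div_cancel_right (volume_closedBall_ne_zero x hr)
      (volume_closedBall_ne_top x r)]
  · exact average_le_maximalFn g x hr

/-- The weak type `(1,1)` inequality, from the Vitali covering lemma. -/
lemma mul_volume_lt_maximalFn_le (hn : n ≠ 0) (F : E n → ℝ≥0∞) (τ : ℝ≥0∞) :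
    τ * volume {x | τ < maximalFn F x} ≤ 4 ^ n * ∫⁻ x, F x := by
  rcases eq_or_ne τ 0 with rfl | hτ
  · simp
  rcases eq_or_ne (∫⁻ x, F x) ⊤ with hJ | hJ
  · simp [hJ]
  set S := {x | τ < maximalFn F x}
  have hex : ∀ x : E n, ∃ r : ℝ, x ∈ S → 0 < r ∧
      τ * volume (Metric.closedBall x r) < ∫⁻ y in Metric.closedBall x r, F y := by
    intro x
    by_cases hx : x ∈ S
    · have hx' : τ < maximalFn F x := hx
      simp only [maximalFn, lt_iSup_iff] at hx'
      obtain ⟨r, hr, h⟩ := hx'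
      refine ⟨r, fun _ => ⟨hr, ?_⟩⟩
      rwa [ENNReal.lt_div_iff_mul_lt (Or.inl (volume_closedBall_ne_zero x hr))
        (Or.inl (volume_closedBall_ne_top x r))] at h
    · exact ⟨0, fun h => absurd h hx⟩
  choose r hr using hex
  set V := volume (Metric.ball (0 : E n) 1) with hV
  set Q : ℝ≥0∞ := (∫⁻ x, F x) / (τ * V) with hQ
  have hQt : Q ≠ ⊤ :=
    ENNReal.div_ne_top hJ (mul_ne_zero hτ volume_unitBall_ne_zero)
  -- the radii are bounded because `τ |B| ≤ ∫ F`
  have hbdd : ∀ a ∈ S, r a ≤ 1 + Q.toReal := by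
    intro a ha
    obtain ⟨h0, h1⟩ := hr a ha
    rw [volume_closedBall_eq a h0.le] at h1
    have h2 : ENNReal.ofReal (r a ^ n) ≤ Q := by
      refine ENNReal.le_div_iff_mul_le ?_ ?_ |>.2 ?_
      · exact Or.inl (mul_ne_zero hτ volume_unitBall_ne_zero)
      · exact Or.inr hJ
      · calc _ = τ * (ENNReal.ofReal (r a ^ n) * V) := by ring
          _ ≤ _ := h1.le.trans (setLIntegral_le_lintegral _ _)
    have h3 : r a ^ n ≤ Q.toReal := (ENNReal.ofReal_le_iff_le_toReal hQt).1 h2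
    rcases le_total (r a) 1 with h | h
    · linarith [ENNReal.toReal_nonneg (a := Q)]
    · linarith [le_self_pow₀ h hn]
  obtain ⟨u, huS, hdisj, hcov⟩ := Vitali.exists_disjoint_subfamily_covering_enlargement_closedBall
    S (fun a => a) r _ hbdd 4 (by norm_num)
  have hucount : u.Countable := hdisj.countable_of_nonempty_interior fun a ha =>
    ⟨a, Metric.ball_subset_interior_closedBall (Metric.mem_ball_self (hr a (huS ha)).1)⟩
  have hsub : S ⊆ ⋃ b ∈ u, Metric.closedBall b (4 * r b) := by
    intro a ha
    obtain ⟨b, hb, hab⟩ := hcov a ha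
    exact mem_biUnion hb (hab (Metric.mem_closedBall_self (hr a ha).1.le))
  calc τ * volume S ≤ τ * ∑' b : u, volume (Metric.closedBall (b : E n) (4 * r b)) := by
        gcongr
        exact (measure_mono hsub).trans (measure_biUnion_le _ hucount _)
    _ = ∑' b : u, 4 ^ n * (τ * volume (Metric.closedBall (b : E n) (r b))) := by
        rw [← ENNReal.tsum_mul_left]
        refine tsum_congr fun b => ?_
        have h0 := (hr b (huS b.2)).1.le
        rw [volume_closedBall_eq _ h0, volume_closedBall_eq _ (by positivity), mul_pow,
          ENNReal.ofReal_mul (by positivity), ENNReal.ofReal_pow (by norm_num)]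
        norm_num
        ring
    _ ≤ ∑' b : u, 4 ^ n * ∫⁻ y in Metric.closedBall (b : E n) (r b), F y := by
        gcongr with b
        exact (hr b (huS b.2)).2.le
    _ = 4 ^ n * ∫⁻ y in ⋃ b ∈ u, Metric.closedBall b (r b), F y := by
        rw [ENNReal.tsum_mul_left, lintegral_biUnion hucount
          (fun _ _ => Metric.isClosed_closedBall.measurableSet) hdisj]
    _ ≤ _ := mul_le_mul' le_rfl (setLIntegral_le_lintegral _ _)

lemma mul_volume_le_maximalFn_le (hn : n ≠ 0) (F : E n → ℝ≥0∞) (τ : ℝ≥0∞) :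
    τ * volume {x | τ ≤ maximalFn F x} ≤ 4 ^ n * ∫⁻ x, F x := by
  refine ENNReal.mul_le_of_forall_lt fun a ha b hb => ?_
  calc a * b ≤ a * volume {x | a < maximalFn F x} := by
        gcongr
        exact hb.le.trans (measure_mono fun x hx => ha.trans_le hx)
    _ ≤ _ := mul_volume_lt_maximalFn_le hn F a

/-- The weak type inequality in which only the large values of `g` count. -/
lemma mul_volume_two_mul_lt_maximalFn_le (hn : n ≠ 0) (g : E n → ℝ≥0∞) (τ : ℝ≥0∞) :
    τ * volume {x | 2 * τ < maximalFn g x} ≤ 4 ^ n * ∫⁻ x, if τ < g x then g x else 0 := by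
  refine le_trans ?_ (mul_volume_lt_maximalFn_le hn _ τ)
  refine mul_le_mul' le_rfl (measure_mono fun x (hx : 2 * τ < maximalFn g x) => ?_)
  change τ < _
  have h1 : maximalFn g x ≤ τ + maximalFn (fun y => if τ < g y then g y else 0) x := by
    refine le_trans (maximalFn_mono (fun y => ?_) x) (maximalFn_const_add_le τ _ x)
    split_ifs with h
    · exact le_add_self
    · simpa using h
  rw [two_mul] at hx
  exact lt_of_add_lt_add_left (hx.trans_le h1)

lemma IsYoung.map_half_maximalFn_le {Φ : ℝ≥0∞ → ℝ≥0∞} (h : IsYoung Φ) (g : E n → ℝ≥0∞)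
    (x : E n) : Φ (maximalFn g x / 2) ≤ maximalFn (fun y => Φ (g y)) x := by
  refine h.map_le_of_forall_lt fun c hc => ?_
  have hc' := (ENNReal.lt_div_iff_mul_lt (by simp) (by simp)).1 hc
  simp only [maximalFn, lt_iSup_iff] at hc'
  obtain ⟨r, hr, hcr⟩ := hc'
  have hcr' := (ENNReal.lt_div_iff_mul_lt (by simp) (by simp)).2 hcr
  refine (h.monotone hcr'.le).trans (le_trans ?_ (average_le_maximalFn _ x hr))
  have := h.map_half_average_le (μ := volume.restrict (Metric.closedBall x r))
    (by simpa using volume_closedBall_ne_zero x hr)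
    (by simpa using volume_closedBall_ne_top x r) g
  simpa using this

/-- The modular weak type inequality for the maximal function. -/
lemma IsYoung.mul_volume_le_map_maximalFn_le_one {Φ : ℝ≥0∞ → ℝ≥0∞} (h : IsYoung Φ) (hn : n ≠ 0)
    {g : E n → ℝ≥0∞} (hg1 : ∫⁻ x, Φ (g x) ≤ 1) (τ : ℝ≥0∞) :
    τ * volume {x | τ ≤ Φ (maximalFn (fun y => (2 * 4 ^ n)⁻¹ * g y) x)} ≤ 1 := by
  have hK : (4 : ℝ≥0∞) ^ n ≠ ⊤ := by simp
  have hK0 : (4 : ℝ≥0∞) ^ n ≠ 0 := by simp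
  have hinv : ((4 : ℝ≥0∞) ^ n)⁻¹ ≠ ⊤ := by simp
  calc _ ≤ τ * volume {x | τ ≤ maximalFn (fun y => Φ ((4 ^ n)⁻¹ * g y)) x} := by
        gcongr with x
        refine le_trans (le_of_eq ?_) (h.map_half_maximalFn_le _ x)
        rw [maximalFn_const_mul hinv, maximalFn_const_mul (by simp), div_eq_mul_inv,
          ENNReal.mul_inv (by simp) (by simp)]
        congr 1
        ring
    _ ≤ 4 ^ n * ∫⁻ x, Φ ((4 ^ n)⁻¹ * g x) := mul_volume_le_maximalFn_le hn _ τ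
    _ ≤ 4 ^ n * ∫⁻ x, (4 ^ n)⁻¹ * Φ (g x) := by
        gcongr with x
        exact h.map_mul_le (ENNReal.inv_le_one.2 (one_le_pow₀ (by norm_num))) _
    _ = ∫⁻ x, Φ (g x) := by
        rw [lintegral_const_mul' _ _ hinv, ← mul_assoc, ENNReal.mul_inv_cancel hK0 hK, one_mul]
    _ ≤ 1 := hg1

end Maximal

/-! ### The strong modular inequality under the `∇₂` condition -/

section Strong

variable {Φ : ℝ≥0∞ → ℝ≥0∞} {C : ℝ≥0∞}

/-- By `∇₂` the numbers `a k = C⁻ᵏ Φ(Cᵏ⁺¹)` satisfy `a k ≤ a (k + 1) / 2`; here this is iterated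
`j` times below `N`. -/
lemma zpow_neg_mul_map_le (hC : C ≠ 0) (hC' : C ≠ ⊤)
    (hΦ : ∀ r, Φ r ≤ (2 * C)⁻¹ * Φ (C * r)) (N : ℤ) (j : ℕ) :
    C ^ (-(N - j)) * Φ (C ^ (N - j + 1)) ≤ 2⁻¹ ^ j * (C ^ (-N) * Φ (C ^ (N + 1))) := by
  induction j with
  | zero => simp
  | succ j ih =>
    refine le_trans ?_ ((mul_le_mul' (le_refl (2⁻¹ : ℝ≥0∞)) ih).trans_eq
      (by rw [← mul_assoc, ← pow_succ']))
    have e1 : N - ((j + 1 : ℕ) : ℤ) + 1 = N - j := by push_cast; ring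
    have e2 : C * C ^ (N - j) = C ^ (N - (j : ℤ) + 1) := by
      rw [ENNReal.zpow_add hC hC', zpow_one, mul_comm]
    have e3 : C ^ (-(N - ((j + 1 : ℕ) : ℤ))) = C * C ^ (-(N - (j : ℤ))) := by
      rw [show -(N - ((j + 1 : ℕ) : ℤ)) = -(N - (j : ℤ)) + 1 by push_cast; ring,
        ENNReal.zpow_add hC hC', zpow_one, mul_comm]
    rw [e1, e3]
    calc C * C ^ (-(N - (j : ℤ))) * Φ (C ^ (N - (j : ℤ)))
        ≤ C * C ^ (-(N - (j : ℤ))) * ((2 * C)⁻¹ * Φ (C * C ^ (N - (j : ℤ)))) := by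
          gcongr; exact hΦ _
      _ = (C * C⁻¹) * (2⁻¹ * (C ^ (-(N - (j : ℤ))) * Φ (C ^ (N - (j : ℤ) + 1)))) := by
          rw [e2, ENNReal.mul_inv (by simp) (by simp)]; ring
      _ = _ := by rw [ENNReal.mul_inv_cancel hC hC', one_mul]

/-- The terms of the series increase geometrically, so that it is at most twice its last one. -/
lemma IsYoung.tsum_zpow_le (h : IsYoung Φ) (hC : 1 < C) (hC' : C ≠ ⊤)
    (hΦ : ∀ r, Φ r ≤ (2 * C)⁻¹ * Φ (C * r)) (t : ℝ≥0∞) :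
    ∑' k : ℤ, (if C ^ k < t then C ^ (-k) * Φ (C ^ (k + 1)) * t else 0) ≤
      2 * C * Φ (C * t) := by
  have hC0 : C ≠ 0 := (zero_lt_one.trans hC).ne'
  rcases eq_or_ne t 0 with rfl | ht
  · simp
  rcases eq_or_ne t ⊤ with rfl | ht'
  · simp [ENNReal.mul_top hC0, h.map_top, hC0]
  obtain ⟨N, hN, hN'⟩ := ENNReal.exists_mem_Ioc_zpow ht ht' hC hC'
  set f : ℤ → ℝ≥0∞ := fun k => if C ^ k < t then C ^ (-k) * Φ (C ^ (k + 1)) * t else 0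
  have hinj : Function.Injective fun j : ℕ => N - (j : ℤ) := fun i j hij => by
    simpa using hij
  have hsupp : Function.support f ⊆ range fun j : ℕ => N - (j : ℤ) := by
    intro k hk
    have hk' : C ^ k < t := by
      by_contra hcon
      exact hk (if_neg hcon)
    have hkN : k ≤ N := by
      by_contra! hcon
      have : C ^ (N + 1) ≤ C ^ k := ENNReal.zpow_le_of_le hC.le (by omega)
      exact absurd (hN'.trans this) (not_le.2 hk')
    exact ⟨(N - k).toNat, by simp only; omega⟩
  rw [← hinj.tsum_eq hsupp]
  calc ∑' j : ℕ, f (N - j) ≤ ∑' j : ℕ, 2⁻¹ ^ j * (C ^ (-N) * Φ (C ^ (N + 1)) * t) := by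
        refine ENNReal.tsum_le_tsum fun j => ?_
        refine (show f (N - j) ≤ C ^ (-(N - (j : ℤ))) * Φ (C ^ (N - (j : ℤ) + 1)) * t by
          simp only [f]; split_ifs <;> simp).trans ?_
        rw [← mul_assoc]
        exact mul_le_mul' (zpow_neg_mul_map_le hC0 hC' hΦ N j) le_rfl
    _ = 2 * (C ^ (-N) * Φ (C ^ (N + 1)) * t) := by
        rw [ENNReal.tsum_mul_right, ENNReal.tsum_geometric, ENNReal.one_sub_inv_two, inv_inv]
    _ ≤ 2 * (C ^ (-N) * Φ (C * t) * C ^ (N + 1)) := by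
        gcongr
        refine h.monotone ?_
        rw [ENNReal.zpow_add hC0 hC', zpow_one, mul_comm]
        gcongr
    _ = 2 * (C ^ (-N) * C ^ (N + 1)) * Φ (C * t) := by ring
    _ = 2 * C * Φ (C * t) := by
        rw [← ENNReal.zpow_add hC0 hC', neg_add_cancel_left, zpow_one]

lemma IsYoung.map_le_tsum_zpow (h : IsYoung Φ) (hC : 1 < C) (hC' : C ≠ ⊤) (s : ℝ≥0∞) :
    Φ s ≤ ∑' k : ℤ, (if C ^ k < s then Φ (C ^ (k + 1)) else 0) := by
  rcases eq_or_ne s 0 with rfl | hs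
  · simp [h.map_zero]
  refine h.map_le_of_forall_lt fun c hc => ?_
  rcases eq_or_ne c 0 with rfl | hc0
  · simp [h.map_zero]
  obtain ⟨N, hN, hN'⟩ := ENNReal.exists_mem_Ioc_zpow hc0 hc.ne_top hC hC'
  refine (h.monotone hN').trans (le_trans ?_ (ENNReal.le_tsum N))
  rw [if_pos (hN.trans hc)]

variable {n : ℕ}

/-- The integral of `Φ (M g)` is cut along the levels `C ^ k`; on each level the weak type
inequality for the large values of `g` applies, and summing over the levels first gives back a
multiple of the integral of `Φ (2 C g)`. -/
lemma IsYoung.lintegral_map_maximalFn_le (h : IsYoung Φ) (hn : n ≠ 0) (hC : 1 < C)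
    (hC' : C ≠ ⊤) (hΦ : ∀ r, Φ r ≤ (2 * C)⁻¹ * Φ (C * r)) {g : E n → ℝ≥0∞}
    (hg : AEMeasurable g) :
    ∫⁻ x, Φ (maximalFn g x) ≤ 4 ^ n * ∫⁻ x, 2 * C * Φ (C * (2 * g x)) := by
  have hC0 : C ≠ 0 := (zero_lt_one.trans hC).ne'
  -- the level sets are replaced by measurable hulls
  set S : ℤ → Set (E n) := fun k => toMeasurable volume {x | C ^ k < maximalFn g x}
  have hlevel : ∀ k : ℤ, volume {x | C ^ k < maximalFn g x} ≤
      4 ^ n * (C ^ (-k) * ∫⁻ x, if C ^ k < 2 * g x then 2 * g x else 0) := by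
    intro k
    have h0 : C ^ k ≠ 0 := (ENNReal.zpow_pos hC0 hC' k).ne'
    have ht : C ^ k ≠ ⊤ := (ENNReal.zpow_lt_top hC0 hC' k).ne
    have h2 : (2 : ℝ≥0∞) * (C ^ k / 2) = C ^ k := ENNReal.mul_div_cancel (by simp) (by simp)
    have key := mul_volume_two_mul_lt_maximalFn_le hn g (C ^ k / 2)
    rw [h2] at key
    have hint : 2 * (∫⁻ x, if C ^ k / 2 < g x then g x else 0) =
        ∫⁻ x, if C ^ k < 2 * g x then 2 * g x else 0 := by
      rw [← lintegral_const_mul' _ _ (by simp)]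
      refine lintegral_congr fun x => ?_
      have : C ^ k / 2 < g x ↔ C ^ k < 2 * g x := by
        rw [ENNReal.div_lt_iff (by simp) (by simp), mul_comm]
      by_cases hx : C ^ k / 2 < g x
      · rw [if_pos hx, if_pos (this.1 hx)]
      · rw [if_neg hx, if_neg (fun hcon => hx (this.2 hcon)), mul_zero]
    calc volume {x | C ^ k < maximalFn g x}
        = C ^ (-k) * (C ^ k * volume {x | C ^ k < maximalFn g x}) := by
          rw [← mul_assoc, ENNReal.zpow_neg, ENNReal.inv_mul_cancel h0 ht, one_mul]
      _ = C ^ (-k) * (2 * (C ^ k / 2 * volume {x | C ^ k < maximalFn g x})) := by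
          rw [← mul_assoc 2, h2]
      _ ≤ C ^ (-k) * (2 * (4 ^ n * ∫⁻ x, if C ^ k / 2 < g x then g x else 0)) := by gcongr
      _ = _ := by rw [← hint]; ring
  calc ∫⁻ x, Φ (maximalFn g x)
      ≤ ∫⁻ x, ∑' k : ℤ, (S k).indicator (fun _ => Φ (C ^ (k + 1))) x := by
        refine lintegral_mono fun x => (h.map_le_tsum_zpow hC hC' _).trans ?_
        refine ENNReal.tsum_le_tsum fun k => ?_
        split_ifs with hk
        · have hx : x ∈ S k := subset_toMeasurable volume {x | C ^ k < maximalFn g x} hk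
          rw [indicator_of_mem hx]
        · exact zero_le
    _ = ∑' k : ℤ, Φ (C ^ (k + 1)) * volume {x | C ^ k < maximalFn g x} := by
        rw [lintegral_tsum fun k =>
          (measurable_const.indicator (measurableSet_toMeasurable _ _)).aemeasurable]
        refine tsum_congr fun k => ?_
        rw [lintegral_indicator_const (measurableSet_toMeasurable _ _), measure_toMeasurable]
    _ ≤ ∑' k : ℤ, Φ (C ^ (k + 1)) *
          (4 ^ n * (C ^ (-k) * ∫⁻ x, if C ^ k < 2 * g x then 2 * g x else 0)) := by
        gcongr with k; exact hlevel k
    _ = 4 ^ n * ∑' k : ℤ, ∫⁻ x,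
          (if C ^ k < 2 * g x then C ^ (-k) * Φ (C ^ (k + 1)) * (2 * g x) else 0) := by
        rw [← ENNReal.tsum_mul_left]
        refine tsum_congr fun k => ?_
        have hmeas : AEMeasurable (fun x => if C ^ k < 2 * g x then 2 * g x else 0) volume :=
          (Measurable.ite (measurableSet_lt measurable_const (measurable_const_mul 2))
            (measurable_const_mul 2) measurable_const :
            Measurable fun t : ℝ≥0∞ => if C ^ k < 2 * t then 2 * t else 0).comp_aemeasurable hg
        have := lintegral_const_mul'' (C ^ (-k) * Φ (C ^ (k + 1))) hmeas
        simp only [mul_ite, mul_zero] at this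
        rw [this]
        ring
    _ = 4 ^ n * ∫⁻ x, ∑' k : ℤ,
          (if C ^ k < 2 * g x then C ^ (-k) * Φ (C ^ (k + 1)) * (2 * g x) else 0) := by
        rw [lintegral_tsum fun k => ?_]
        exact (Measurable.ite (measurableSet_lt measurable_const (measurable_const_mul 2))
            ((measurable_const_mul 2).const_mul _) measurable_const :
            Measurable fun t : ℝ≥0∞ =>
              if C ^ k < 2 * t then C ^ (-k) * Φ (C ^ (k + 1)) * (2 * t) else 0).comp_aemeasurable
            hg
    _ ≤ _ := by
        gcongr with x
        exact h.tsum_zpow_le hC hC' hΦ _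

/-- The strong modular inequality for the maximal function. -/
lemma IsYoung.exists_lintegral_map_maximalFn_le_one (h : IsYoung Φ) (hn : n ≠ 0)
    (hΦ : Nabla2 Φ) : ∃ A : ℝ≥0, 1 ≤ A ∧ ∀ g : E n → ℝ≥0∞, AEMeasurable g →
      ∫⁻ x, Φ (g x) ≤ 1 → ∫⁻ x, Φ (maximalFn (fun y => (A : ℝ≥0∞)⁻¹ * g y) x) ≤ 1 := by
  obtain ⟨C, hC, hΦ⟩ := hΦ
  have hC0 : C ≠ 0 := (zero_lt_one.trans hC).ne'
  have hCE : (1 : ℝ≥0∞) < C := by exact_mod_cast hC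
  set B : ℝ≥0∞ := 4 ^ n * (2 * C) with hB
  have hB0 : B ≠ 0 := by simp [hB, hC0]
  have hBt : B ≠ ⊤ := by simp [hB, ENNReal.mul_eq_top]
  have hB1 : 1 ≤ B := by
    refine one_le_mul (one_le_pow₀ (by norm_num)) (one_le_mul (by norm_num) hCE.le)
  refine ⟨2 * C * (4 ^ n * (2 * C)), ?_, fun g hg hg1 => ?_⟩
  · have h2C : 1 ≤ 2 * C := one_le_mul (by norm_num) hC.le
    exact one_le_mul h2C (one_le_mul (one_le_pow₀ (by norm_num)) h2C)
  have hA : ((2 * C * (4 ^ n * (2 * C)) : ℝ≥0) : ℝ≥0∞) = 2 * C * B := by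
    rw [hB]; push_cast; rfl
  rw [hA]
  have h2C : (2 * C : ℝ≥0∞) ≠ 0 := by simp [hC0]
  have h2C' : (2 * C : ℝ≥0∞) ≠ ⊤ := by simp [ENNReal.mul_eq_top]
  calc _ ≤ 4 ^ n * ∫⁻ x, 2 * C * Φ (C * (2 * ((2 * C * B)⁻¹ * g x))) :=
        h.lintegral_map_maximalFn_le hn hCE (by simp) hΦ (hg.const_mul _)
    _ = 4 ^ n * ∫⁻ x, 2 * C * Φ (B⁻¹ * g x) := by
        congr 1
        refine lintegral_congr fun x => ?_
        have : C * (2 * ((2 * C * B)⁻¹ * g x)) = B⁻¹ * g x := by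
          rw [ENNReal.mul_inv (Or.inl h2C) (Or.inl h2C')]
          calc (C : ℝ≥0∞) * (2 * ((2 * C : ℝ≥0∞)⁻¹ * B⁻¹ * g x))
              = (2 * C * (2 * C : ℝ≥0∞)⁻¹) * (B⁻¹ * g x) := by ring
            _ = _ := by rw [ENNReal.mul_inv_cancel h2C h2C', one_mul]
        rw [this]
    _ ≤ 4 ^ n * ∫⁻ x, 2 * C * (B⁻¹ * Φ (g x)) := by
        gcongr
        exact h.map_mul_le (ENNReal.inv_le_one.2 hB1) _
    _ = (B * B⁻¹) * ∫⁻ x, Φ (g x) := by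
        rw [lintegral_const_mul' _ _ h2C', lintegral_const_mul' _ _ (by simpa using hB0), hB]
        ring
    _ ≤ 1 := by rw [ENNReal.mul_inv_cancel hB0 hBt, one_mul]; exact hg1

end Strong

/-! ### The pointwise estimate of Hedberg type -/

section Pointwise

variable {n : ℕ}

/-- The operator `I_ρ` on `[0,∞]`-valued functions. -/
noncomputable def fracLInt (ρ : ℝ → ℝ) (g : E n → ℝ≥0∞) (x : E n) : ℝ≥0∞ :=
  ∫⁻ y, ENNReal.ofReal (ρ ‖x - y‖ / ‖x - y‖ ^ n) * g y

lemma fracLInt_const_mul (ρ : ℝ → ℝ) {c : ℝ≥0∞} (hc : c ≠ ⊤) (g : E n → ℝ≥0∞) (x : E n) :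
    fracLInt ρ (fun y => c * g y) x = c * fracLInt ρ g x := by
  simp only [fracLInt, mul_left_comm _ c, lintegral_const_mul' c _ hc]

lemma IsYoung.youngInv_mul_le_max {Φ : ℝ≥0∞ → ℝ≥0∞} (h : IsYoung Φ) {c : ℝ≥0∞} (hc : c ≠ ⊤)
    (s : ℝ≥0∞) : youngInv Φ (c * s) ≤ max 1 c * youngInv Φ s :=
  (youngInv_mono Φ (mul_le_mul' (le_max_right 1 c) le_rfl)).trans
    (h.youngInv_mul_le (le_max_left 1 c) (by simp [hc]) s)

/-- The kernel at distance `d` is compared with an integral of `ρ(t)/t` over `t > k₁ d`, by the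
hypothesis at `r = d`; no dyadic decomposition is needed. -/
lemma ofReal_kernel_le {ρ : ℝ → ℝ} (hn : n ≠ 0) {C k₁ k₂ : ℝ} (hk₁ : 0 < k₁) (hk : k₁ < k₂)
    (hS : ∀ r : ℝ, 0 < r → (⨆ t ∈ Icc (r / 2) r, ENNReal.ofReal (ρ t)) ≤
      ENNReal.ofReal C * logInt ρ (Ioc (k₁ * r) (k₂ * r))) {d : ℝ} (hd : 0 ≤ d) :
    ENNReal.ofReal (ρ d / d ^ n) ≤ ENNReal.ofReal C *
      ∫⁻ t in Ioi 0, (if k₁ * d < t then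
        ENNReal.ofReal (ρ t / t) * ENNReal.ofReal ((k₂ / t) ^ n) else 0) := by
  rcases hd.eq_or_lt with rfl | hd
  · simp [hn]
  have h1 : ENNReal.ofReal (ρ d) ≤ ENNReal.ofReal C * logInt ρ (Ioc (k₁ * d) (k₂ * d)) :=
    (le_iSup₂_of_le (f := fun t (_ : t ∈ Icc (d / 2) d) => ENNReal.ofReal (ρ t)) d
      ⟨by linarith, le_rfl⟩ le_rfl).trans (hS d hd)
  rw [div_eq_mul_inv, ENNReal.ofReal_mul' (by positivity)]
  calc ENNReal.ofReal (ρ d) * ENNReal.ofReal (d ^ n)⁻¹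
      ≤ ENNReal.ofReal C * logInt ρ (Ioc (k₁ * d) (k₂ * d)) * ENNReal.ofReal (d ^ n)⁻¹ := by
        gcongr
    _ = ENNReal.ofReal C * ∫⁻ t in Ioc (k₁ * d) (k₂ * d),
          ENNReal.ofReal (ρ t / t) * ENNReal.ofReal (d ^ n)⁻¹ := by
        rw [lintegral_mul_const' _ _ ENNReal.ofReal_ne_top, mul_assoc]; rfl
    _ ≤ ENNReal.ofReal C * ∫⁻ t in Ioc (k₁ * d) (k₂ * d), (if k₁ * d < t then
        ENNReal.ofReal (ρ t / t) * ENNReal.ofReal ((k₂ / t) ^ n) else 0) := by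
        refine mul_le_mul' le_rfl (setLIntegral_mono' measurableSet_Ioc fun t ht => ?_)
        have ht0 : 0 < t := lt_trans (by positivity) ht.1
        rw [if_pos ht.1, ← inv_pow]
        gcongr
        rw [inv_le_comm₀ hd (div_pos (hk₁.trans hk) ht0), inv_div, div_le_iff₀ (hk₁.trans hk), mul_comm]
        exact ht.2
    _ ≤ _ := by
        refine mul_le_mul' le_rfl (lintegral_mono_set fun t ht => ?_)
        exact lt_trans (by positivity) ht.1

lemma fracLInt_le_lintegral_average {ρ : ℝ → ℝ} (hρ : Measurable ρ) (hn : n ≠ 0) {C k₁ k₂ : ℝ}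
    (hk₁ : 0 < k₁) (hk : k₁ < k₂)
    (hS : ∀ r : ℝ, 0 < r → (⨆ t ∈ Icc (r / 2) r, ENNReal.ofReal (ρ t)) ≤
      ENNReal.ofReal C * logInt ρ (Ioc (k₁ * r) (k₂ * r)))
    {g : E n → ℝ≥0∞} (hg : AEMeasurable g) (x : E n) :
    fracLInt ρ g x ≤ ENNReal.ofReal C *
      (ENNReal.ofReal ((k₂ / k₁) ^ n) * volume (Metric.ball (0 : E n) 1)) *
      ∫⁻ t in Ioi 0, ENNReal.ofReal (ρ t / t) *
        ((∫⁻ y in Metric.closedBall x (t / k₁), g y) /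
          volume (Metric.closedBall x (t / k₁))) := by
  have hk₂ := hk₁.trans hk
  set w : ℝ → ℝ≥0∞ := fun t => ENNReal.ofReal (ρ t / t) * ENNReal.ofReal ((k₂ / t) ^ n) with hw
  have hwm : Measurable w := by fun_prop
  set V := volume (Metric.ball (0 : E n) 1) with hV
  have hVt : V ≠ ⊤ := volume_unitBall_ne_top
  have hmeas : AEMeasurable (Function.uncurry fun (y : E n) (t : ℝ) =>
      (if k₁ * ‖x - y‖ < t then w t else 0) * g y) (volume.prod (volume.restrict (Ioi 0))) := by
    refine AEMeasurable.mul (Measurable.aemeasurable ?_)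
      (hg.comp_quasiMeasurePreserving Measure.quasiMeasurePreserving_fst)
    exact Measurable.ite (measurableSet_lt (by fun_prop) measurable_snd)
      (hwm.comp measurable_snd) measurable_const
  calc fracLInt ρ g x ≤ ∫⁻ y, ENNReal.ofReal C * ∫⁻ t in Ioi 0,
        (if k₁ * ‖x - y‖ < t then w t else 0) * g y := by
        refine lintegral_mono fun y => ?_
        have hm : Measurable fun t => if k₁ * ‖x - y‖ < t then w t else 0 :=
          Measurable.ite measurableSet_Ioi hwm measurable_const
        rw [lintegral_mul_const _ hm, ← mul_assoc]
        exact mul_le_mul' (ofReal_kernel_le hn hk₁ hk hS (norm_nonneg _)) le_rfl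
    _ = ENNReal.ofReal C * ∫⁻ t in Ioi 0, ∫⁻ y, (if k₁ * ‖x - y‖ < t then w t else 0) * g y := by
        rw [lintegral_const_mul' _ _ ENNReal.ofReal_ne_top, lintegral_lintegral_swap hmeas]
    _ ≤ ENNReal.ofReal C * ∫⁻ t in Ioi 0, ENNReal.ofReal ((k₂ / k₁) ^ n) * V *
          (ENNReal.ofReal (ρ t / t) * ((∫⁻ y in Metric.closedBall x (t / k₁), g y) /
            volume (Metric.closedBall x (t / k₁)))) := by
        refine mul_le_mul' le_rfl (setLIntegral_mono' measurableSet_Ioi fun t (ht : 0 < t) => ?_)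
        have htk : 0 < t / k₁ := by positivity
        calc ∫⁻ y, (if k₁ * ‖x - y‖ < t then w t else 0) * g y
            ≤ ∫⁻ y, w t * (Metric.closedBall x (t / k₁)).indicator g y := by
              refine lintegral_mono fun y => ?_
              by_cases h : k₁ * ‖x - y‖ < t
              · have hy : y ∈ Metric.closedBall x (t / k₁) := by
                  rw [mem_closedBall_iff_norm', le_div_iff₀ hk₁, mul_comm]
                  exact h.le
                rw [if_pos h, indicator_of_mem hy]
              · simp [h]
          _ = w t * ∫⁻ y in Metric.closedBall x (t / k₁), g y := by
              rw [lintegral_const_mul' _ _ (ENNReal.mul_ne_top (by simp) (by simp)),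
                lintegral_indicator Metric.isClosed_closedBall.measurableSet]
          _ = w t * (volume (Metric.closedBall x (t / k₁)) *
                ((∫⁻ y in Metric.closedBall x (t / k₁), g y) /
                  volume (Metric.closedBall x (t / k₁)))) := by
              rw [ENNReal.mul_div_cancel (volume_closedBall_ne_zero x htk)
                (volume_closedBall_ne_top x _)]
          _ = _ := by
              rw [volume_closedBall_eq x htk.le, ← hV]
              have : (k₂ / k₁) ^ n = (k₂ / t) ^ n * (t / k₁) ^ n := by
                rw [← mul_pow]; congr 1; field_simp
              rw [this, ENNReal.ofReal_mul (by positivity)]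
              simp only [hw]
              ring
    _ = _ := by
        rw [lintegral_const_mul' _ _ (ENNReal.mul_ne_top (by simp) hVt)]
        ring

/-- Jensen's inequality bounds the averages of a function with modular at most `1`. -/
lemma IsYoung.average_le_invPow {Φ : ℝ≥0∞ → ℝ≥0∞} (h : IsYoung Φ) {g : E n → ℝ≥0∞}
    (hg1 : ∫⁻ x, Φ (g x) ≤ 1) (x : E n) {k t : ℝ} (hk : 0 < k) (ht : 0 < t) :
    (∫⁻ y in Metric.closedBall x (t / k), g y) / volume (Metric.closedBall x (t / k)) ≤
      2 * max 1 (ENNReal.ofReal (k ^ n) / volume (Metric.ball (0 : E n) 1)) * invPow n Φ t := by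
  have htk : 0 < t / k := by positivity
  set B := Metric.closedBall x (t / k)
  have hB0 : volume B ≠ 0 := volume_closedBall_ne_zero x htk
  have hBt : volume B ≠ ⊤ := volume_closedBall_ne_top x _
  have h1 : Φ ((∫⁻ y in B, g y) / volume B / 2) ≤ (volume B)⁻¹ := by
    have := h.map_half_average_le (μ := volume.restrict B) (by simpa using hB0)
      (by simpa using hBt) g
    simp only [Measure.restrict_apply_univ] at this
    refine this.trans ?_
    rw [← one_div]
    gcongr
    exact (setLIntegral_le_lintegral _ _).trans hg1
  have h2 : (volume B)⁻¹ = ENNReal.ofReal (k ^ n) / volume (Metric.ball (0 : E n) 1) *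
      ENNReal.ofReal (t ^ n)⁻¹ := by
    rw [volume_closedBall_eq x htk.le, ENNReal.mul_inv (Or.inl (by simp; positivity))
      (Or.inl ENNReal.ofReal_ne_top), ← ENNReal.ofReal_inv_of_pos (by positivity), div_pow,
      inv_div, div_eq_mul_inv, ENNReal.ofReal_mul (by positivity), div_eq_mul_inv]
    ring
  rw [h2] at h1
  have h3 := (h.le_youngInv h1).trans (h.youngInv_mul_le_max
    (ENNReal.div_ne_top ENNReal.ofReal_ne_top volume_unitBall_ne_zero) _)
  rw [ENNReal.div_le_iff (by simp) (by simp)] at h3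
  exact h3.trans_eq (by rw [invPow]; ring)

/-- The Hedberg splitting at an arbitrary radius `R`: averages over radii below `R` are bounded by
the maximal function, the others by `Φ⁻¹(t⁻ⁿ)`. -/
lemma exists_fracLInt_le {ρ : ℝ → ℝ} (hρ : Measurable ρ) (hn : n ≠ 0) (hS : SupRho ρ)
    {Φ : ℝ≥0∞ → ℝ≥0∞} (h : IsYoung Φ) :
    ∃ A : ℝ≥0, 0 < A ∧ ∀ g : E n → ℝ≥0∞, AEMeasurable g → ∫⁻ x, Φ (g x) ≤ 1 →
      ∀ (x : E n) (R : ℝ), 0 < R →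
        fracLInt ρ g x ≤ A * (maximalFn g x * logInt ρ (Ioc 0 R) + tailTerm n ρ Φ R) := by
  obtain ⟨C, k₁, k₂, hC, hk₁, hk, hS⟩ := hS
  have hk₂ := hk₁.trans hk
  set V := volume (Metric.ball (0 : E n) 1) with hV
  set D : ℝ≥0∞ := ENNReal.ofReal C * (ENNReal.ofReal ((k₂ / k₁) ^ n) * V)
  set K : ℝ≥0∞ := 2 * max 1 (ENNReal.ofReal (k₁ ^ n) / V)
  have hD0 : D ≠ 0 := mul_ne_zero (by simpa using hC)
    (mul_ne_zero (by simp; positivity) volume_unitBall_ne_zero)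
  have hDt : D ≠ ⊤ := ENNReal.mul_ne_top (by simp)
    (ENNReal.mul_ne_top (by simp) volume_unitBall_ne_top)
  have hK1 : 1 ≤ K := one_le_mul (by norm_num) (le_max_left _ _)
  have hKt : K ≠ ⊤ := by
    have := ENNReal.div_ne_top (ENNReal.ofReal_ne_top (r := k₁ ^ n))
      (volume_unitBall_ne_zero (n := n))
    exact ENNReal.mul_ne_top (by simp) (by simpa using this)
  have hDK : D * K ≠ ⊤ := ENNReal.mul_ne_top hDt hKt
  refine ⟨(D * K).toNNReal, ENNReal.toNNReal_pos
    (mul_ne_zero hD0 (zero_lt_one.trans_le hK1).ne') hDK, fun g hg hg1 x R hR => ?_⟩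
  rw [ENNReal.coe_toNNReal hDK, mul_assoc]
  refine (fracLInt_le_lintegral_average hρ hn hk₁ hk hS hg x).trans (mul_le_mul' le_rfl ?_)
  have hmeas : Measurable fun t => ENNReal.ofReal (ρ t / t) := by fun_prop
  rw [← Ioc_union_Ioi_eq_Ioi hR.le, lintegral_union measurableSet_Ioi
    (Ioc_disjoint_Ioi le_rfl), mul_add]
  refine add_le_add ?_ ?_
  · calc _ ≤ ∫⁻ t in Ioc 0 R, ENNReal.ofReal (ρ t / t) * maximalFn g x := by
          refine setLIntegral_mono' measurableSet_Ioc fun t ht => ?_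
          gcongr
          exact average_le_maximalFn g x (div_pos ht.1 hk₁)
      _ = 1 * (maximalFn g x * logInt ρ (Ioc 0 R)) := by
          rw [lintegral_mul_const _ hmeas, one_mul, mul_comm]; rfl
      _ ≤ _ := mul_le_mul' hK1 le_rfl
  · calc _ ≤ ∫⁻ t in Ioi R, K * (ENNReal.ofReal (ρ t / t) * invPow n Φ t) := by
          refine setLIntegral_mono' measurableSet_Ioi fun t (ht : R < t) => ?_
          rw [mul_left_comm]
          gcongr
          exact h.average_le_invPow hg1 x hk₁ (hR.trans ht)
      _ = _ := lintegral_const_mul' _ _ hKt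

/-- `Ψ (I g / A) ≤ Φ (M g)`: the splitting radius `R` is chosen so that `R⁻ⁿ` exceeds `Φ (M g)`
by arbitrarily little. -/
lemma exists_map_fracLInt_le {ρ : ℝ → ℝ} (hρ : Measurable ρ) (hn : n ≠ 0) (hS : SupRho ρ)
    {Φ Ψ : ℝ≥0∞ → ℝ≥0∞} (h : IsYoung Φ) (hΨ : IsYoung Ψ)
    (hdom : DominatedBy n (fun r => localTerm n ρ Φ r + tailTerm n ρ Φ r) Ψ) :
    ∃ A : ℝ≥0, 0 < A ∧ ∀ g : E n → ℝ≥0∞, AEMeasurable g → ∫⁻ x, Φ (g x) ≤ 1 →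
      ∀ x : E n, Ψ ((A : ℝ≥0∞)⁻¹ * fracLInt ρ g x) ≤ Φ (maximalFn g x) := by
  obtain ⟨A, hA, hI⟩ := exists_fracLInt_le (n := n) hρ hn hS h
  obtain ⟨C, hC, hdom⟩ := hdom
  refine ⟨A * C, by positivity, fun g hg hg1 x => ?_⟩
  refine le_of_forall_gt_imp_ge_of_dense fun s hs => ?_
  rcases eq_or_ne s ⊤ with rfl | hst
  · exact le_top
  have hs0 : 0 < s.toReal := ENNReal.toReal_pos (pos_of_gt hs).ne' hst
  obtain ⟨R, hR, hRs⟩ : ∃ R : ℝ, 0 < R ∧ ENNReal.ofReal (R ^ n)⁻¹ = s := by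
    refine ⟨s.toReal⁻¹ ^ ((n : ℝ)⁻¹), by positivity, ?_⟩
    rw [Real.rpow_inv_natCast_pow (by positivity) hn, inv_inv, ENNReal.ofReal_toReal hst]
  have hM : maximalFn g x ≤ invPow n Φ R := by
    rw [invPow, hRs]; exact h.le_youngInv hs.le
  have hle : fracLInt ρ g x ≤ (A * C : ℝ≥0) * invPow n Ψ R := by
    refine (hI g hg hg1 x R hR).trans ?_
    rw [ENNReal.coe_mul, mul_assoc]
    refine mul_le_mul' le_rfl (le_trans ?_ (hdom R hR))
    exact add_le_add (mul_le_mul' hM le_rfl) le_rfl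
  calc Ψ _ ≤ Ψ (invPow n Ψ R) := by
        refine hΨ.monotone ?_
        rw [mul_comm, ← div_eq_mul_inv]
        exact ENNReal.div_le_of_le_mul' hle
    _ ≤ s := by rw [invPow, hRs]; exact hΨ.map_youngInv_le s

end Pointwise

/-! ### Orlicz and weak Orlicz norms -/

section Norms

variable {n : ℕ} {F : Type*} [NormedAddCommGroup F] {Φ : ℝ≥0∞ → ℝ≥0∞} {f : E n → F}

/-- The infimum defining the norm of an element of `L^Φ` is over a nonempty set. -/
lemma IsYoung.exists_lintegral_le_one (h : IsYoung Φ) (hf : MemOrlicz Φ f) :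
    ∃ l : ℝ≥0∞, 0 < l ∧ l < ⊤ ∧ ∫⁻ x, Φ (‖f x‖ₑ / l) ≤ 1 := by
  obtain ⟨-, k, hk, hJ⟩ := hf
  set J := ∫⁻ x, Φ (k * ‖f x‖ₑ)
  have hk' : (k : ℝ≥0∞) ≠ 0 := by simpa using hk.ne'
  have hm1 : 1 ≤ max 1 J := le_max_left _ _
  have hm0 : max 1 J ≠ 0 := (zero_lt_one.trans_le hm1).ne'
  have hmt : max 1 J ≠ ⊤ := by simp [hJ.ne]
  have hmi : (max 1 J)⁻¹ ≠ ⊤ := by simp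
  refine ⟨max 1 J / k, ENNReal.div_pos hm0 (by simp), ENNReal.div_lt_top hmt hk', ?_⟩
  calc ∫⁻ x, Φ (‖f x‖ₑ / (max 1 J / k)) = ∫⁻ x, Φ ((max 1 J)⁻¹ * (k * ‖f x‖ₑ)) := by
        refine lintegral_congr fun x => ?_
        rw [div_eq_mul_inv, ENNReal.inv_div (by simp) (Or.inr hm0), div_eq_mul_inv]
        congr 1
        ring
    _ ≤ ∫⁻ x, (max 1 J)⁻¹ * Φ (k * ‖f x‖ₑ) :=
        lintegral_mono fun x => h.map_mul_le (ENNReal.inv_le_one.2 hm1) _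
    _ = (max 1 J)⁻¹ * J := lintegral_const_mul' _ _ hmi
    _ ≤ (max 1 J)⁻¹ * max 1 J := by gcongr; exact le_max_right _ _
    _ = 1 := ENNReal.inv_mul_cancel hm0 hmt

lemma orliczNorm_le {l : ℝ≥0∞} (hl : 0 < l) (hl' : l < ⊤) (h1 : ∫⁻ x, Φ (‖f x‖ₑ / l) ≤ 1) :
    orliczNorm Φ f ≤ l :=
  sInf_le ⟨hl, hl', h1⟩

lemma IsYoung.orliczNorm_lt_top (h : IsYoung Φ) (hf : MemOrlicz Φ f) : orliczNorm Φ f < ⊤ := by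
  obtain ⟨l, hl, hl', h1⟩ := h.exists_lintegral_le_one hf
  exact (orliczNorm_le hl hl' h1).trans_lt hl'

lemma le_mul_orliczNorm {a C : ℝ≥0∞} (hC : C ≠ 0) (hC' : C ≠ ⊤)
    (ha : ∀ l : ℝ≥0∞, 0 < l → l < ⊤ → ∫⁻ x, Φ (‖f x‖ₑ / l) ≤ 1 → a ≤ C * l) :
    a ≤ C * orliczNorm Φ f := by
  rw [mul_comm, ← ENNReal.div_le_iff hC hC']
  exact le_sInf fun l hl => ENNReal.div_le_of_le_mul' (ha l hl.1 hl.2.1 hl.2.2)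

lemma IsYoung.weakOrliczNorm_le_orliczNorm (h : IsYoung Φ) (f : E n → F) :
    weakOrliczNorm Φ f ≤ orliczNorm Φ f := by
  refine iSup₂_le fun m hm => sInf_le_sInf fun l hl => ⟨hl.1, hl.2.1, le_trans ?_ hl.2.2⟩
  refine lintegral_mono fun x => h.monotone (ENNReal.div_le_div_right ?_ _)
  by_cases hx : m < ‖f x‖
  · rw [indicator_of_mem (show x ∈ {x | m < ‖f x‖} from hx), Real.enorm_of_nonneg hm.le,
      ← ofReal_norm]
    exact ENNReal.ofReal_le_ofReal hx.le
  · rw [indicator_of_notMem (show x ∉ {x | m < ‖f x‖} from hx)]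
    simp

/-- The weak norm is controlled by the measure of the superlevel sets of any function `G`
dominating `|f|`. -/
lemma IsYoung.weakOrliczNorm_le (h : IsYoung Φ) {G : E n → ℝ≥0∞} (hG : ∀ x, ‖f x‖ₑ ≤ G x)
    {l : ℝ≥0∞} (hl : 0 < l) (hl' : l < ⊤)
    (hτ : ∀ τ, τ * volume {x | τ ≤ Φ (G x / l)} ≤ 1) : weakOrliczNorm Φ f ≤ l := by
  refine iSup₂_le fun m hm => orliczNorm_le hl hl' ?_
  calc ∫⁻ x, Φ (‖{x : E n | m < ‖f x‖}.indicator (fun _ => m) x‖ₑ / l)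
      ≤ ∫⁻ x, {x : E n | m < ‖f x‖}.indicator (fun _ => Φ (ENNReal.ofReal m / l)) x := by
        refine lintegral_mono fun x => ?_
        by_cases hx : x ∈ {x : E n | m < ‖f x‖}
        · rw [indicator_of_mem hx, indicator_of_mem hx, Real.enorm_of_nonneg hm.le]
        · simp [indicator_of_notMem hx, h.map_zero]
    _ ≤ Φ (ENNReal.ofReal m / l) * volume {x : E n | m < ‖f x‖} := lintegral_indicator_const_le _ _
    _ ≤ Φ (ENNReal.ofReal m / l) *
          volume {x | Φ (ENNReal.ofReal m / l) ≤ Φ (G x / l)} := by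
        refine mul_le_mul' le_rfl (measure_mono fun x (hx : m < ‖f x‖) => ?_)
        refine h.monotone (ENNReal.div_le_div_right (le_trans ?_ (hG x)) _)
        rw [← ofReal_norm]
        exact ENNReal.ofReal_le_ofReal hx.le
    _ ≤ 1 := hτ _

/-- A finite modular forces local integrability, because a Young function has an affine minorant
of positive slope. -/
lemma IsYoung.memOrlicz_of_lintegral_le_one (h : IsYoung Φ) (hf : AEStronglyMeasurable f volume)
    {l : ℝ≥0∞} (hl : 0 < l) (hl' : l < ⊤) (h1 : ∫⁻ x, Φ (‖f x‖ₑ / l) ≤ 1) : MemOrlicz Φ f := by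
  refine ⟨locallyIntegrable_iff.2 fun K hK => ⟨hf.restrict, ?_⟩,
    l⁻¹.toNNReal, ENNReal.toNNReal_pos (by simpa using hl'.ne) (by simpa using hl.ne'), ?_⟩
  · obtain ⟨c, hct, hc⟩ := h.exists_lt_map (s := 0) (by simp)
    have hc0 : c ≠ 0 := by
      rintro rfl
      simp [h.map_zero] at hc
    have hs0 : Φ c / c ≠ 0 := (ENNReal.div_pos hc.ne' hct.ne).ne'
    have hI : ∫⁻ x, (‖f x‖ₑ / l - c) ≠ ⊤ := by
      intro htop
      have : Φ c / c * ∫⁻ x, (‖f x‖ₑ / l - c) ≤ 1 :=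
        (lintegral_const_mul_le _ _).trans
          ((lintegral_mono fun x => h.slope_mul_sub_le hc0 hct.ne _).trans h1)
      rw [htop, ENNReal.mul_top hs0] at this
      simp at this
    have hle : ∫⁻ x in K, ‖f x‖ₑ ≤ l * ((∫⁻ x, (‖f x‖ₑ / l - c)) + c * volume K) := by
      calc ∫⁻ x in K, ‖f x‖ₑ ≤ ∫⁻ x in K, l * ((‖f x‖ₑ / l - c) + c) := by
            refine lintegral_mono fun x => ?_
            calc ‖f x‖ₑ = l * (‖f x‖ₑ / l) := (ENNReal.mul_div_cancel hl.ne' hl'.ne).symm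
              _ ≤ _ := by gcongr; exact le_tsub_add
        _ = l * ((∫⁻ x in K, (‖f x‖ₑ / l - c)) + c * volume K) := by
            rw [lintegral_const_mul' _ _ hl'.ne, lintegral_add_right _ measurable_const,
              setLIntegral_const]
        _ ≤ _ := mul_le_mul' le_rfl (add_le_add (setLIntegral_le_lintegral _ _) le_rfl)
    refine lt_of_le_of_lt hle (ENNReal.mul_lt_top hl' (ENNReal.add_lt_top.2 ⟨hI.lt_top, ?_⟩))
    exact ENNReal.mul_lt_top hct hK.measure_lt_top
  · rw [ENNReal.coe_toNNReal (by simpa using hl.ne')]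
    simp only [mul_comm l⁻¹, ← div_eq_mul_inv]
    exact h1.trans_lt ENNReal.one_lt_top

end Norms

/-! ### Boundedness under the integral condition -/

section Sufficiency

variable {𝕜 : Type*} [RCLike 𝕜] {n : ℕ} {ρ : ℝ → ℝ}

lemma enorm_fracIntegrand (hn : n ≠ 0) (hρpos : ∀ t : ℝ, 0 < t → 0 < ρ t) (f : E n → 𝕜)
    (x y : E n) : ‖fracIntegrand ρ f x y‖ₑ =
      ENNReal.ofReal (ρ ‖x - y‖ / ‖x - y‖ ^ n) * ‖f y‖ₑ := by
  have h0 : 0 ≤ ρ ‖x - y‖ / ‖x - y‖ ^ n := by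
    rcases (norm_nonneg (x - y)).eq_or_lt with h | h
    · simp [← h, hn]
    · exact div_nonneg (hρpos _ h).le (by positivity)
  rw [fracIntegrand, enorm_mul, ← ofReal_norm (E := 𝕜) (_ : 𝕜), RCLike.norm_ofReal,
    abs_of_nonneg h0]

lemma enorm_fracInt_le (hn : n ≠ 0) (hρpos : ∀ t : ℝ, 0 < t → 0 < ρ t) (f : E n → 𝕜) (x : E n) :
    ‖fracInt ρ f x‖ₑ ≤ fracLInt ρ (fun y => ‖f y‖ₑ) x :=
  (enorm_integral_le_lintegral_enorm _).trans_eq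
    (lintegral_congr fun y => enorm_fracIntegrand hn hρpos f x y)

lemma measurable_fracKernel (hρ : Measurable ρ) :
    Measurable fun p : E n × E n => ((ρ ‖p.1 - p.2‖ / ‖p.1 - p.2‖ ^ n : ℝ) : 𝕜) := by
  fun_prop

lemma aestronglyMeasurable_fracIntegrand (hρ : Measurable ρ) {f : E n → 𝕜}
    (hf : AEStronglyMeasurable f volume) (x : E n) :
    AEStronglyMeasurable (fracIntegrand ρ f x) volume :=
  ((measurable_fracKernel hρ).comp measurable_prodMk_left).aestronglyMeasurable.mul hf

lemma aestronglyMeasurable_fracInt (hρ : Measurable ρ) {f : E n → 𝕜}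
    (hf : AEStronglyMeasurable f volume) : AEStronglyMeasurable (fracInt ρ f) volume := by
  have : AEStronglyMeasurable (fun p : E n × E n => fracIntegrand ρ f p.1 p.2)
      (volume.prod volume) :=
    (measurable_fracKernel hρ).aestronglyMeasurable.mul
      (hf.comp_quasiMeasurePreserving Measure.quasiMeasurePreserving_snd)
  exact this.integral_prod_right'

variable {Φ Ψ : ℝ≥0∞ → ℝ≥0∞}

/-- The pointwise estimate for `f / (B l)`; the factor `B` makes room for the constants in the
modular inequalities for the maximal function. -/
lemma exists_map_fracLInt_enorm_le (hρ : Measurable ρ) (hn : n ≠ 0) (hS : SupRho ρ)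
    (h : IsYoung Φ) (hΨ : IsYoung Ψ)
    (hdom : DominatedBy n (fun r => localTerm n ρ Φ r + tailTerm n ρ Φ r) Ψ) :
    ∃ A : ℝ≥0, 0 < A ∧ ∀ (B : ℝ≥0), 1 ≤ B → ∀ f : E n → 𝕜, AEStronglyMeasurable f volume →
      ∀ l : ℝ≥0∞, 0 < l → l < ⊤ → ∫⁻ x, Φ (‖f x‖ₑ / l) ≤ 1 → ∀ x,
        Ψ (fracLInt ρ (fun y => ‖f y‖ₑ) x / ((A * B : ℝ≥0) * l)) ≤
          Φ (maximalFn (fun y => (B : ℝ≥0∞)⁻¹ * (‖f y‖ₑ / l)) x) := by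
  obtain ⟨A, hA, H⟩ := exists_map_fracLInt_le (n := n) hρ hn hS h hΨ hdom
  refine ⟨A, hA, fun B hB f hf l hl hl' h1 x => ?_⟩
  have hB0 : (B : ℝ≥0∞) ≠ 0 := by
    simpa using (zero_lt_one.trans_le hB).ne'
  have hB1 : (1 : ℝ≥0∞) ≤ B := by exact_mod_cast hB
  have hBi : (B : ℝ≥0∞)⁻¹ ≠ ⊤ := by simpa using hB0
  have hli : l⁻¹ ≠ ⊤ := by simpa using hl.ne'
  refine le_trans (le_of_eq ?_) (H (fun y => (B : ℝ≥0∞)⁻¹ * (‖f y‖ₑ / l))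
    ((hf.enorm.div_const l).const_mul _) ?_ x)
  · simp only [div_eq_mul_inv, mul_comm _ l⁻¹]
    rw [fracLInt_const_mul ρ hBi, fracLInt_const_mul ρ hli, ENNReal.coe_mul,
      ENNReal.mul_inv (Or.inr hl'.ne) (Or.inr hl.ne'),
      ENNReal.mul_inv (Or.inr (by simp)) (Or.inr hB0)]
    congr 1
    ring
  · refine (lintegral_mono fun y => h.monotone ?_).trans h1
    exact mul_le_of_le_one_left' (ENNReal.inv_le_one.2 hB1)

theorem weakBounded_of_dominatedBy (hn : n ≠ 0) (hρ : Measurable ρ)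
    (hρpos : ∀ t : ℝ, 0 < t → 0 < ρ t) (h : IsYoung Φ) (hΨ : IsYoung Ψ) (hS : SupRho ρ)
    (hdom : DominatedBy n (fun r => localTerm n ρ Φ r + tailTerm n ρ Φ r) Ψ) :
    WeakBounded 𝕜 n ρ Φ Ψ := by
  obtain ⟨A, hA, H⟩ := exists_map_fracLInt_enorm_le (𝕜 := 𝕜) (n := n) hρ hn hS h hΨ hdom
  set C : ℝ≥0 := A * (2 * 4 ^ n) with hC
  have hCpos : 0 < C := by positivity
  have hC0 : (C : ℝ≥0∞) ≠ 0 := by simpa using hCpos.ne'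
  refine ⟨C, fun f hf => ?_⟩
  have hfm : AEStronglyMeasurable f volume := hf.1.aestronglyMeasurable
  have key : ∀ l : ℝ≥0∞, 0 < l → l < ⊤ → ∫⁻ x, Φ (‖f x‖ₑ / l) ≤ 1 → ∀ τ : ℝ≥0∞,
      τ * volume {x | τ ≤ Ψ (fracLInt ρ (fun y => ‖f y‖ₑ) x / (C * l))} ≤ 1 := by
    intro l hl hl' h1 τ
    refine le_trans ?_ (h.mul_volume_le_map_maximalFn_le_one hn h1 τ)
    refine mul_le_mul' le_rfl (measure_mono fun x hx => ?_)
    refine le_trans (show τ ≤ Ψ (fracLInt ρ (fun y => ‖f y‖ₑ) x / (C * l)) from hx) ?_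
    have := H (2 * 4 ^ n) (one_le_mul (by norm_num) (one_le_pow₀ (by norm_num))) f hfm l hl hl' h1 x
    simpa [hC] using this
  have hweak : ∀ l : ℝ≥0∞, 0 < l → l < ⊤ → ∫⁻ x, Φ (‖f x‖ₑ / l) ≤ 1 →
      weakOrliczNorm Ψ (fracInt ρ f) ≤ C * l := fun l hl hl' h1 =>
    hΨ.weakOrliczNorm_le (enorm_fracInt_le hn hρpos f) (ENNReal.mul_pos hC0 hl.ne')
      (ENNReal.mul_lt_top (by simp) hl') (key l hl hl' h1)
  obtain ⟨l, hl, hl', h1⟩ := h.exists_lintegral_le_one hf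
  refine ⟨?_, ⟨aestronglyMeasurable_fracInt hρ hfm, ?_⟩, ?_⟩
  · have hCl : (C : ℝ≥0∞) * l ≠ ⊤ := (ENNReal.mul_lt_top (by simp) hl').ne
    -- the level `τ = ∞` in the weak type inequality
    have h0 : volume {x | ⊤ ≤ Ψ (fracLInt ρ (fun y => ‖f y‖ₑ) x / (C * l))} = 0 := by
      by_contra hne
      have := key l hl hl' h1 ⊤
      rw [ENNReal.top_mul hne] at this
      simp at this
    have hae : ∀ᵐ x, fracLInt ρ (fun y => ‖f y‖ₑ) x < ⊤ := by
      refine measure_mono_null (fun x hx => ?_) h0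
      have hx' : fracLInt ρ (fun y => ‖f y‖ₑ) x = ⊤ := by simpa using hx
      simp [hx', ENNReal.top_div_of_ne_top hCl, hΨ.map_top]
    filter_upwards [hae] with x hx
    refine ⟨aestronglyMeasurable_fracIntegrand hρ hfm x, lt_of_le_of_lt (le_of_eq ?_) hx⟩
    exact lintegral_congr fun y => enorm_fracIntegrand hn hρpos f x y
  · exact (hweak l hl hl' h1).trans_lt (ENNReal.mul_lt_top (by simp) hl')
  · exact le_mul_orliczNorm hC0 (by simp) hweak

theorem strongBounded_of_dominatedBy (hn : n ≠ 0) (hρ : Measurable ρ)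
    (hρpos : ∀ t : ℝ, 0 < t → 0 < ρ t) (h : IsYoung Φ) (hΨ : IsYoung Ψ) (hS : SupRho ρ)
    (hdom : DominatedBy n (fun r => localTerm n ρ Φ r + tailTerm n ρ Φ r) Ψ)
    (hN : Nabla2 Φ) : StrongBounded 𝕜 n ρ Φ Ψ := by
  obtain ⟨_, hw⟩ := weakBounded_of_dominatedBy (𝕜 := 𝕜) hn hρ hρpos h hΨ hS hdom
  obtain ⟨A, hA, H⟩ := exists_map_fracLInt_enorm_le (𝕜 := 𝕜) (n := n) hρ hn hS h hΨ hdom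
  obtain ⟨B, hB, HM⟩ := h.exists_lintegral_map_maximalFn_le_one hn hN
  have hCpos : 0 < A * B := mul_pos hA (zero_lt_one.trans_le hB)
  have hC0 : ((A * B : ℝ≥0) : ℝ≥0∞) ≠ 0 := by exact_mod_cast hCpos.ne'
  refine ⟨A * B, fun f hf => ?_⟩
  have hfm : AEStronglyMeasurable f volume := hf.1.aestronglyMeasurable
  have key : ∀ l : ℝ≥0∞, 0 < l → l < ⊤ → ∫⁻ x, Φ (‖f x‖ₑ / l) ≤ 1 →
      ∫⁻ x, Ψ (‖fracInt ρ f x‖ₑ / ((A * B : ℝ≥0) * l)) ≤ 1 := fun l hl hl' h1 =>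
    (lintegral_mono fun x => (hΨ.monotone (ENNReal.div_le_div_right
      (enorm_fracInt_le hn hρpos f x) _)).trans (H B hB f hfm l hl hl' h1 x)).trans
      (HM _ (hfm.enorm.div_const l) h1)
  have hpos : ∀ l : ℝ≥0∞, 0 < l → 0 < ((A * B : ℝ≥0) : ℝ≥0∞) * l := fun l hl =>
    ENNReal.mul_pos hC0 hl.ne'
  have hlt : ∀ l : ℝ≥0∞, l < ⊤ → ((A * B : ℝ≥0) : ℝ≥0∞) * l < ⊤ := fun l hl =>
    ENNReal.mul_lt_top ENNReal.coe_lt_top hl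
  obtain ⟨l, hl, hl', h1⟩ := h.exists_lintegral_le_one hf
  refine ⟨(hw f hf).1, ?_, ?_⟩
  · exact hΨ.memOrlicz_of_lintegral_le_one (aestronglyMeasurable_fracInt hρ hfm) (hpos l hl)
      (hlt l hl') (key l hl hl' h1)
  · exact le_mul_orliczNorm hC0 ENNReal.coe_ne_top fun l hl hl' h1 =>
      orliczNorm_le (hpos l hl) (hlt l hl') (key l hl hl' h1)

end Sufficiency

/-! ### Necessity of the local condition -/

section Necessity

variable {𝕜 : Type*} [RCLike 𝕜] {n : ℕ} {ρ : ℝ → ℝ} {Φ Ψ : ℝ≥0∞ → ℝ≥0∞}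

/-- Integration in polar coordinates of a radial `[0,∞]`-valued function. -/
lemma lintegral_fun_norm (hn : n ≠ 0) {f : ℝ → ℝ≥0∞} (hf : Measurable f) :
    ∫⁻ x : E n, f ‖x‖ = n * volume (Metric.ball (0 : E n) 1) *
      ∫⁻ t in Ioi (0 : ℝ), ENNReal.ofReal (t ^ (n - 1)) * f t := by
  have : NeZero n := ⟨hn⟩
  have hdim : Module.finrank ℝ (E n) = n := by simp
  set μ : Measure (E n) := volume
  calc ∫⁻ x : E n, f ‖x‖ = ∫⁻ x : ({(0 : E n)}ᶜ : Set (E n)), f ‖x.1‖ ∂(μ.comap (↑)) := by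
        rw [lintegral_subtype_comap (measurableSet_singleton _).compl fun x : E n => f ‖x‖,
          restrict_compl_singleton]
    _ = ∫⁻ x, f x.2 ∂μ.toSphere.prod (.volumeIoiPow (n - 1)) := by
        have := μ.measurePreserving_homeomorphUnitSphereProd.lintegral_comp_emb
          (Homeomorph.measurableEmbedding _) (f ∘ Subtype.val ∘ Prod.snd)
        rw [hdim] at this
        simpa using this
    _ = μ.toSphere univ * ∫⁻ t : Ioi (0 : ℝ), f t ∂.volumeIoiPow (n - 1) := by
        rw [lintegral_prod _ (by fun_prop)]
        rw [mul_comm]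
        exact lintegral_const (μ := μ.toSphere) (∫⁻ t : Ioi (0 : ℝ), f t ∂.volumeIoiPow (n - 1))
    _ = _ := by
        have hm : Measurable fun t : Ioi (0 : ℝ) => ENNReal.ofReal ((t : ℝ) ^ (n - 1)) := by
          fun_prop
        rw [Measure.toSphere_apply_univ, hdim, Measure.volumeIoiPow]
        congr 1
        exact (lintegral_withDensity_eq_lintegral_mul _ hm (hf.comp measurable_subtype_coe)).trans
          (lintegral_subtype_comap measurableSet_Ioi fun t => ENNReal.ofReal (t ^ (n - 1)) * f t)

lemma lintegral_kernel_ball (hn : n ≠ 0) (hρ : Measurable ρ) {r : ℝ} :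
    ∫⁻ y in Metric.ball (0 : E n) r, ENNReal.ofReal (ρ ‖y‖ / ‖y‖ ^ n) =
      n * volume (Metric.ball (0 : E n) 1) * logInt ρ (Ioc 0 r) := by
  have hm : Measurable ((Iio r).indicator fun t => ENNReal.ofReal (ρ t / t ^ n)) :=
    Measurable.indicator (by fun_prop) measurableSet_Iio
  calc _ = ∫⁻ y : E n, (Iio r).indicator (fun t => ENNReal.ofReal (ρ t / t ^ n)) ‖y‖ := by
        rw [← lintegral_indicator measurableSet_ball]
        refine lintegral_congr fun y => ?_
        by_cases hy : ‖y‖ < r <;> simp [indicator, hy]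
    _ = n * volume (Metric.ball (0 : E n) 1) * ∫⁻ t in Ioi (0 : ℝ), ENNReal.ofReal (t ^ (n - 1)) *
          (Iio r).indicator (fun t => ENNReal.ofReal (ρ t / t ^ n)) t := lintegral_fun_norm hn hm
    _ = n * volume (Metric.ball (0 : E n) 1) * ∫⁻ t in Ioi (0 : ℝ),
          (Iio r).indicator (fun t => ENNReal.ofReal (ρ t / t)) t := by
        congr 1
        refine setLIntegral_congr_fun measurableSet_Ioi fun t (ht : 0 < t) => ?_
        by_cases htr : t ∈ Iio r
        · simp only [indicator_of_mem htr]
          rw [← ENNReal.ofReal_mul (by positivity)]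
          congr 1
          obtain ⟨m, rfl⟩ := Nat.exists_eq_succ_of_ne_zero hn
          rw [Nat.succ_sub_one, pow_succ]
          field_simp
        · simp only [indicator_of_notMem htr, mul_zero]
    _ = _ := by
        rw [lintegral_indicator measurableSet_Iio, Measure.restrict_restrict measurableSet_Iio,
          inter_comm, Ioi_inter_Iio, logInt, restrict_Ioo_eq_restrict_Ioc]

/-- For the indicator function of the ball of radius `2r`, the operator is bounded below on the
ball of radius `r`. -/
lemma le_enorm_fracInt_indicator (hn : n ≠ 0) (hρ : Measurable ρ)
    (hρpos : ∀ t : ℝ, 0 < t → 0 < ρ t) {r : ℝ} {x : E n} (hx : x ∈ Metric.ball (0 : E n) r)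
    (hint : Integrable (fracIntegrand ρ
      ((Metric.ball (0 : E n) (2 * r)).indicator fun _ => (1 : 𝕜)) x)) :
    n * volume (Metric.ball (0 : E n) 1) * logInt ρ (Ioc 0 r) ≤
      ‖fracInt ρ ((Metric.ball (0 : E n) (2 * r)).indicator fun _ => (1 : 𝕜)) x‖ₑ := by
  set B := Metric.ball (0 : E n) (2 * r)
  set φ : E n → ℝ := fun y => ρ ‖x - y‖ / ‖x - y‖ ^ n * B.indicator (fun _ => (1 : ℝ)) y with hφ
  have hφf : fracIntegrand ρ (B.indicator fun _ => (1 : 𝕜)) x = fun y => ((φ y : ℝ) : 𝕜) := by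
    funext y
    by_cases hy : y ∈ B <;> simp [fracIntegrand, hφ, hy]
  have h0 : ∀ y, 0 ≤ φ y := fun y => by
    refine mul_nonneg ?_ (indicator_nonneg (fun _ _ => zero_le_one) _)
    rcases (norm_nonneg (x - y)).eq_or_lt with h | h
    · simp [← h, hn]
    · exact div_nonneg (hρpos _ h).le (by positivity)
  have hφi : Integrable φ := by
    rw [hφf] at hint
    simpa using hint.re
  have heq : ‖fracInt ρ (B.indicator fun _ => (1 : 𝕜)) x‖ₑ = ∫⁻ y, ENNReal.ofReal (φ y) := by
    rw [fracInt, hφf, integral_ofReal, ← ofReal_norm, RCLike.norm_ofReal,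
      abs_of_nonneg (integral_nonneg h0),
      ofReal_integral_eq_lintegral_ofReal hφi (Eventually.of_forall h0)]
  rw [heq, ← lintegral_kernel_ball hn hρ]
  calc ∫⁻ y in Metric.ball (0 : E n) r, ENNReal.ofReal (ρ ‖y‖ / ‖y‖ ^ n)
      = ∫⁻ y, (Metric.ball (0 : E n) r).indicator
          (fun y => ENNReal.ofReal (ρ ‖y‖ / ‖y‖ ^ n)) y := by
        rw [lintegral_indicator measurableSet_ball]
    _ = ∫⁻ y, (Metric.ball (0 : E n) r).indicator
          (fun y => ENNReal.ofReal (ρ ‖y‖ / ‖y‖ ^ n)) (x - y) :=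
        (lintegral_sub_left_eq_self _ x).symm
    _ ≤ _ := by
        refine lintegral_mono fun y => ?_
        by_cases hy : x - y ∈ Metric.ball (0 : E n) r
        · have hyB : y ∈ B := by
            rw [mem_ball_zero_iff] at hx hy ⊢
            calc ‖y‖ = ‖x - (x - y)‖ := by rw [sub_sub_cancel]
              _ ≤ ‖x‖ + ‖x - y‖ := norm_sub_le _ _
              _ < 2 * r := by linarith
          simp [indicator_of_mem hy, hφ, hyB]
        · simp [indicator_of_notMem hy]

lemma IsYoung.invPow_lt_top (h : IsYoung Φ) (r : ℝ) : invPow n Φ r < ⊤ :=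
  h.youngInv_lt_top ENNReal.ofReal_lt_top

lemma IsYoung.invPow_pos (h : IsYoung Φ) {r : ℝ} (hr : 0 < r) : 0 < invPow n Φ r :=
  h.youngInv_pos (ENNReal.ofReal_pos.2 (by positivity))

lemma IsYoung.invPow_le_mul_invPow_two_mul (h : IsYoung Φ) (r : ℝ) :
    invPow n Φ r ≤ 2 ^ n * invPow n Φ (2 * r) := by
  refine le_trans (le_of_eq ?_) (h.youngInv_mul_le (one_le_pow₀ (by norm_num)) (by simp) _)
  rw [invPow]
  congr 1
  rw [show (2 : ℝ≥0∞) ^ n = ENNReal.ofReal (2 ^ n) by simp [ENNReal.ofReal_pow],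
    ← ENNReal.ofReal_mul (by positivity)]
  congr 1
  rw [mul_pow, mul_inv, ← mul_assoc, mul_inv_cancel₀ (by positivity), one_mul]

lemma volume_ball_eq (hn : n ≠ 0) (x : E n) {r : ℝ} (hr : 0 ≤ r) :
    volume (Metric.ball x r) =
      ENNReal.ofReal (r ^ n) * volume (Metric.ball (0 : E n) 1) := by
  have : NeZero n := ⟨hn⟩
  simpa using Measure.addHaar_ball (volume : Measure (E n)) x hr

lemma IsYoung.memOrlicz_indicator_ball (h : IsYoung Φ) (r : ℝ) :
    MemOrlicz Φ ((Metric.ball (0 : E n) r).indicator fun _ => (1 : 𝕜)) := by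
  refine ⟨(integrable_indicator_iff measurableSet_ball |>.2
    (integrableOn_const measure_ball_lt_top.ne)).locallyIntegrable, ?_⟩
  obtain ⟨k, hk, hkt, hΦk⟩ := h.exists_map_le zero_lt_one
  lift k to ℝ≥0 using hkt.ne
  refine ⟨k, by exact_mod_cast hk, ?_⟩
  refine lt_of_le_of_lt (lintegral_mono (g := (Metric.ball (0 : E n) r).indicator fun _ => 1)
    fun x => ?_) ?_
  · by_cases hx : x ∈ Metric.ball (0 : E n) r
    · rw [indicator_of_mem hx, indicator_of_mem hx]
      simpa using hΦk
    · rw [indicator_of_notMem hx]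
      simp [h.map_zero]
  · rw [lintegral_indicator_const measurableSet_ball, one_mul]
    exact measure_ball_lt_top

lemma IsYoung.orliczNorm_indicator_ball_le (h : IsYoung Φ) (hn : n ≠ 0) {r : ℝ} (hr : 0 < r) :
    orliczNorm Φ ((Metric.ball (0 : E n) r).indicator fun _ => (1 : 𝕜)) ≤
      max 1 (volume (Metric.ball (0 : E n) 1)) / invPow n Φ r := by
  set B := Metric.ball (0 : E n) r
  set V := volume (Metric.ball (0 : E n) 1)
  set a := invPow n Φ r
  have ha0 : a ≠ 0 := (h.invPow_pos hr).ne'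
  have hat : a ≠ ⊤ := (h.invPow_lt_top r).ne
  have hm1 : 1 ≤ max 1 V := le_max_left _ _
  have hm0 : max 1 V ≠ 0 := (zero_lt_one.trans_le hm1).ne'
  have hmt : max 1 V ≠ ⊤ := by simpa using (volume_unitBall_ne_top (n := n))
  refine orliczNorm_le (ENNReal.div_pos hm0 hat) (ENNReal.div_lt_top hmt ha0) ?_
  calc ∫⁻ x, Φ (‖B.indicator (fun _ => (1 : 𝕜)) x‖ₑ / (max 1 V / a))
      = ∫⁻ x, B.indicator (fun _ => Φ ((max 1 V)⁻¹ * a)) x := by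
        refine lintegral_congr fun x => ?_
        by_cases hx : x ∈ B
        · rw [indicator_of_mem hx, indicator_of_mem hx, enorm_one, one_div,
            ENNReal.inv_div (Or.inl hat) (Or.inl ha0), div_eq_mul_inv, mul_comm]
        · rw [indicator_of_notMem hx, indicator_of_notMem hx]
          simp [h.map_zero]
    _ = Φ ((max 1 V)⁻¹ * a) * volume B := lintegral_indicator_const measurableSet_ball _
    _ ≤ (max 1 V)⁻¹ * ENNReal.ofReal (r ^ n)⁻¹ * (ENNReal.ofReal (r ^ n) * V) := by
        rw [volume_ball_eq hn 0 hr.le]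
        gcongr
        exact (h.map_mul_le (ENNReal.inv_le_one.2 hm1) _).trans
          (mul_le_mul' le_rfl (h.map_youngInv_le _))
    _ = (max 1 V)⁻¹ * V * (ENNReal.ofReal (r ^ n)⁻¹ * ENNReal.ofReal (r ^ n)) := by ring
    _ = (max 1 V)⁻¹ * V := by
        rw [← ENNReal.ofReal_mul (by positivity), inv_mul_cancel₀ (by positivity),
          ENNReal.ofReal_one, mul_one]
    _ ≤ (max 1 V)⁻¹ * max 1 V := by gcongr; exact le_max_right _ _
    _ = 1 := ENNReal.inv_mul_cancel hm0 hmt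

/-- A lower bound for the weak norm of a function that is at least `J` on a ball. -/
lemma IsYoung.le_mul_weakOrliczNorm {F : Type*} [NormedAddCommGroup F] (h : IsYoung Ψ)
    (hn : n ≠ 0) {f : E n → F} {J : ℝ≥0∞} {r : ℝ} (hr : 0 < r)
    (hJ : ∀ᵐ x, x ∈ Metric.ball (0 : E n) r → J ≤ ‖f x‖ₑ) :
    J ≤ max 1 (volume (Metric.ball (0 : E n) 1))⁻¹ * invPow n Ψ r * weakOrliczNorm Ψ f := by
  set V := volume (Metric.ball (0 : E n) 1)
  set B := Metric.ball (0 : E n) r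
  have hVi : V⁻¹ ≠ ⊤ := by simpa using (volume_unitBall_ne_zero (n := n))
  set P := max 1 V⁻¹ * invPow n Ψ r
  have hP0 : P ≠ 0 := mul_ne_zero (zero_lt_one.trans_le (le_max_left _ _)).ne'
    (h.invPow_pos hr).ne'
  have hPt : P ≠ ⊤ := ENNReal.mul_ne_top (by simpa using hVi) (h.invPow_lt_top r).ne
  refine le_of_forall_lt_imp_le_of_dense fun c hc => ?_
  rcases eq_or_ne c 0 with rfl | hc0
  · exact zero_le
  have hct : c ≠ ⊤ := hc.ne_top
  have hcpos : 0 < c.toReal := ENNReal.toReal_pos hc0 hct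
  refine le_trans ?_ (mul_le_mul' (le_refl P) (le_iSup₂_of_le (f := fun (l : ℝ) (_ : 0 < l) =>
    orliczNorm Ψ ({x : E n | l < ‖f x‖}.indicator (fun _ => l))) c.toReal hcpos le_rfl))
  refine le_mul_orliczNorm hP0 hPt fun l hl hl' h1 => ?_
  have hB : Ψ (c / l) * volume B ≤ 1 := by
    refine le_trans ?_ h1
    rw [← lintegral_indicator_const measurableSet_ball]
    refine lintegral_mono_ae ?_
    filter_upwards [hJ] with x hx
    by_cases hxB : x ∈ B
    · have hlt : c.toReal < ‖f x‖ := by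
        have h2 : c < ‖f x‖ₑ := hc.trans_le (hx hxB)
        rw [← toReal_enorm]
        exact (ENNReal.toReal_lt_toReal hct enorm_ne_top).2 h2
      rw [indicator_of_mem hxB, indicator_of_mem (show x ∈ {x | c.toReal < ‖f x‖} from hlt),
        Real.enorm_of_nonneg hcpos.le, ENNReal.ofReal_toReal hct]
    · rw [indicator_of_notMem hxB]
      exact zero_le
  have hle : Ψ (c / l) ≤ V⁻¹ * ENNReal.ofReal (r ^ n)⁻¹ := by
    rw [volume_ball_eq hn 0 hr.le] at hB
    have hr0 : ENNReal.ofReal (r ^ n) ≠ 0 := by simp; positivity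
    rw [ENNReal.ofReal_inv_of_pos (by positivity), mul_comm V⁻¹,
      ← ENNReal.mul_inv (Or.inl hr0) (Or.inl ENNReal.ofReal_ne_top), ← one_div]
    exact (ENNReal.le_div_iff_mul_le (Or.inl (mul_ne_zero hr0 volume_unitBall_ne_zero))
      (Or.inr ENNReal.one_ne_top)).2 hB
  have := (h.le_youngInv hle).trans (h.youngInv_mul_le_max hVi _)
  rwa [ENNReal.div_le_iff hl.ne' hl'.ne] at this

theorem dominatedBy_localTerm_of_weakBounded (hn : n ≠ 0) (hρ : Measurable ρ)
    (hρpos : ∀ t : ℝ, 0 < t → 0 < ρ t) (h : IsYoung Φ) (hΨ : IsYoung Ψ)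
    (hw : WeakBounded 𝕜 n ρ Φ Ψ) : DominatedBy n (localTerm n ρ Φ) Ψ := by
  obtain ⟨C, hC⟩ := hw
  set V := volume (Metric.ball (0 : E n) 1) with hV
  have hV0 : V ≠ 0 := volume_unitBall_ne_zero
  have hVt : V ≠ ⊤ := volume_unitBall_ne_top
  set Q : ℝ≥0∞ := (n * V)⁻¹ * (2 ^ n * (max 1 V⁻¹ * (C * max 1 V))) with hQ
  have hnV0 : n * V ≠ 0 := mul_ne_zero (by simpa using hn) hV0
  have hnVt : n * V ≠ ⊤ := ENNReal.mul_ne_top (by simp) hVt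
  have hQt : Q ≠ ⊤ := by
    have h1 : max 1 V⁻¹ ≠ ⊤ := by simpa using hV0
    have h2 : max 1 V ≠ ⊤ := by simpa using hVt
    exact ENNReal.mul_ne_top (by simpa using hnV0) (ENNReal.mul_ne_top (by simp)
      (ENNReal.mul_ne_top h1 (ENNReal.mul_ne_top (by simp) h2)))
  refine ⟨Q.toNNReal + 1, by positivity, fun r hr => ?_⟩
  have hr2 : 0 < 2 * r := by positivity
  obtain ⟨hint, -, hle⟩ := hC _ (h.memOrlicz_indicator_ball (𝕜 := 𝕜) (n := n) (2 * r))
  have hlow : n * V * logInt ρ (Ioc 0 r) ≤ _ := hΨ.le_mul_weakOrliczNorm hn hr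
    (hint.mono fun x hx hxB => le_enorm_fracInt_indicator hn hρ hρpos hxB hx)
  have hup := hlow.trans (mul_le_mul' le_rfl (hle.trans (mul_le_mul' le_rfl
    (h.orliczNorm_indicator_ball_le hn hr2))))
  rw [← hV] at hup
  set a := invPow n Φ (2 * r)
  have ha0 : a ≠ 0 := (h.invPow_pos hr2).ne'
  have hat : a ≠ ⊤ := (h.invPow_lt_top _).ne
  calc localTerm n ρ Φ r ≤ 2 ^ n * a * logInt ρ (Ioc 0 r) :=
        mul_le_mul' (h.invPow_le_mul_invPow_two_mul r) le_rfl
    _ = (n * V)⁻¹ * (n * V) * (2 ^ n * a * logInt ρ (Ioc 0 r)) := by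
        rw [ENNReal.inv_mul_cancel hnV0 hnVt, one_mul]
    _ = (n * V)⁻¹ * 2 ^ n * a * (n * V * logInt ρ (Ioc 0 r)) := by ring
    _ ≤ (n * V)⁻¹ * 2 ^ n * a * (max 1 V⁻¹ * invPow n Ψ r * (C * (max 1 V / a))) := by gcongr
    _ = (a⁻¹ * a) * (Q * invPow n Ψ r) := by rw [div_eq_mul_inv, hQ]; ring
    _ = Q * invPow n Ψ r := by rw [ENNReal.inv_mul_cancel ha0 hat, one_mul]
    _ ≤ _ := by
        rw [ENNReal.coe_add, ENNReal.coe_toNNReal hQt]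
        gcongr
        exact le_self_add

lemma StrongBounded.weakBounded (h : IsYoung Φ) (hΨ : IsYoung Ψ)
    (hs : StrongBounded 𝕜 n ρ Φ Ψ) : WeakBounded 𝕜 n ρ Φ Ψ := by
  obtain ⟨C, hC⟩ := hs
  refine ⟨C, fun f hf => ?_⟩
  obtain ⟨h1, h2, h3⟩ := hC f hf
  have h4 := (hΨ.weakOrliczNorm_le_orliczNorm (fracInt ρ f)).trans h3
  exact ⟨h1, ⟨h2.1.aestronglyMeasurable,
    h4.trans_lt (ENNReal.mul_lt_top (by simp) (h.orliczNorm_lt_top hf))⟩, h4⟩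

end Necessity

lemma DominatedBy.add {n : ℕ} {A B : ℝ → ℝ≥0∞} {Ψ : ℝ≥0∞ → ℝ≥0∞} (hA : DominatedBy n A Ψ)
    (hB : DominatedBy n B Ψ) : DominatedBy n (fun r => A r + B r) Ψ := by
  obtain ⟨C, hC, hA⟩ := hA
  obtain ⟨D, -, hB⟩ := hB
  refine ⟨C + D, by positivity, fun r hr => ?_⟩
  rw [ENNReal.coe_add, add_mul]
  exact add_le_add (hA r hr) (hB r hr)

end OrliczFrac

theorem mainTheorem1 (𝕜 : Type*) [RCLike 𝕜] (n : ℕ) (hn : 1 ≤ n)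
    (ρ : ℝ → ℝ) (hρ : Measurable ρ) (hρpos : ∀ t : ℝ, 0 < t → 0 < ρ t)
    (Φ Ψ : ℝ≥0∞ → ℝ≥0∞) (hΦ : OrliczFrac.IsYoung Φ) (hΨ : OrliczFrac.IsYoung Ψ) :
    -- sufficiency of the full condition
    (OrliczFrac.IntRho ρ → OrliczFrac.SupRho ρ →
      OrliczFrac.DominatedBy n
        (fun r => OrliczFrac.localTerm n ρ Φ r + OrliczFrac.tailTerm n ρ Φ r) Ψ →
      OrliczFrac.WeakBounded 𝕜 n ρ Φ Ψ ∧
        (OrliczFrac.Nabla2 Φ → OrliczFrac.StrongBounded 𝕜 n ρ Φ Ψ)) ∧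
    -- necessity of the local condition
    ((OrliczFrac.WeakBounded 𝕜 n ρ Φ Ψ → OrliczFrac.DominatedBy n (OrliczFrac.localTerm n ρ Φ) Ψ) ∧
      (OrliczFrac.StrongBounded 𝕜 n ρ Φ Ψ →
        OrliczFrac.DominatedBy n (OrliczFrac.localTerm n ρ Φ) Ψ)) ∧
    -- characterization under the tail condition
    (OrliczFrac.IntRho ρ → OrliczFrac.SupRho ρ →
      OrliczFrac.DominatedBy n (OrliczFrac.tailTerm n ρ Φ) Ψ →
      (OrliczFrac.DominatedBy n (OrliczFrac.localTerm n ρ Φ) Ψ ↔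
        OrliczFrac.WeakBounded 𝕜 n ρ Φ Ψ) ∧
      (OrliczFrac.Nabla2 Φ →
        (OrliczFrac.DominatedBy n (OrliczFrac.localTerm n ρ Φ) Ψ ↔
          OrliczFrac.StrongBounded 𝕜 n ρ Φ Ψ))) := by
  have hn0 : n ≠ 0 := by omega
  have hnec : OrliczFrac.WeakBounded 𝕜 n ρ Φ Ψ →
      OrliczFrac.DominatedBy n (OrliczFrac.localTerm n ρ Φ) Ψ :=
    OrliczFrac.dominatedBy_localTerm_of_weakBounded hn0 hρ hρpos hΦ hΨ
  refine ⟨fun _ hS hdom => ?_, ⟨hnec, fun hs => hnec (hs.weakBounded hΦ hΨ)⟩,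
    fun _ hS htail => ?_⟩
  · exact ⟨OrliczFrac.weakBounded_of_dominatedBy hn0 hρ hρpos hΦ hΨ hS hdom,
      OrliczFrac.strongBounded_of_dominatedBy hn0 hρ hρpos hΦ hΨ hS hdom⟩
  · exact ⟨⟨fun hloc =>
        OrliczFrac.weakBounded_of_dominatedBy hn0 hρ hρpos hΦ hΨ hS (hloc.add htail), hnec⟩,
      fun hN => ⟨fun hloc =>
        OrliczFrac.strongBounded_of_dominatedBy hn0 hρ hρpos hΦ hΨ hS (hloc.add htail) hN,
        fun hs => hnec (hs.weakBounded hΦ hΨ)⟩⟩
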